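/- Let $n\ge 0$, let $\mathbb K$ be a field of any characteristic, and let $\xi=\sum_{a\in\mathbb Z^n}\xi_a x^a$ be a formal Laurent series in $x=(x_1,\dots,x_n)$ with coefficients $\xi_a\in\mathbb K$ and support $\mathrm{Supp}(\xi)=\{a\in\mathbb Z^n\mid \xi_a\ne 0\}$. A polyhedral cone in $\mathbb R^n$ is a set of the form $\{\lambda_1u_1+\cdots+\lambda_su_s\mid\lambda_1,\dots,\lambda_s\ge 0\}$ with $u_1,\dots,u_s\in\mathbb R^n$ (for $s=0$ it is $\{0\}$); it is rational if the $u_i$ can be chosen in $\mathbb Z^n$, and strongly convex if it contains no nonzero linear subspace. Assume that $\mathrm{Supp}(\xi)\subset\gamma+\sigma$ for some $\gamma\in\mathbb R^n$ and some strongly convex polyhedral cone $\sigma\subset\mathbb R^n$ containing ${\mathbb R_{\ge 0}}^n$. Assume also that $\xi$ is algebraic over the fraction field $\mathbb K(\!(x)\!)$ of the ring $\mathbb K[[x]]$ of formal power series; that is, there is a nonzero polynomial $P\in\mathbb K[[x]][T]$ with $P(\xi)=0$ (all the products of series occurring in $P(\xi)$ are well defined, because the supports lie in translates of $\sigma$).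 Then $$\tau(\xi)=\left\{\omega\in{\mathbb R_{\ge 0}}^n\mid \exists k\in\mathbb R,\ \mathrm{Supp}(\xi)\cap\{u\in\mathbb R^n\mid u\cdot\omega\le k\}=\emptyset\right\}$$ is a strongly convex rational polyhedral cone. -/

import Mathlib

namespace LaurentCone

/-! ### Cones in real coordinate space -/

/-- The polyhedral cone of all combinations, with nonnegative real coefficients, of the
elements of a finite set of vectors. The empty set generates the cone `{0}`. -/
def coneGeneratedBy {n : ℕ} (s : Finset (Fin n → ℝ)) : Set (Fin n → ℝ) :=
  {v | ∃ c : (Fin n → ℝ) → ℝ, (∀ u ∈ s, 0 ≤ c u) ∧ v = ∑ u ∈ s, c u • u}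

/-- A lattice point seen as a real vector. -/
def toReal {n : ℕ} (a : Fin n → ℤ) : Fin n → ℝ := fun i => (a i : ℝ)

/-- A polyhedral cone: a cone generated by finitely many real vectors. -/
def IsPolyhedralCone {n : ℕ} (σ : Set (Fin n → ℝ)) : Prop :=
  ∃ s : Finset (Fin n → ℝ), σ = coneGeneratedBy s

/-- A rational (polyhedral) cone: the generators can be chosen in the integer lattice. -/
def IsRationalCone {n : ℕ} (σ : Set (Fin n → ℝ)) : Prop :=
  ∃ s : Finset (Fin n → ℝ), (∀ u ∈ s, ∃ a : Fin n → ℤ, u = toReal a) ∧ σ = coneGeneratedBy s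

/-- A cone is strongly convex if it contains no nontrivial linear subspace. -/
def IsStronglyConvex {n : ℕ} (σ : Set (Fin n → ℝ)) : Prop :=
  ∀ W : Submodule ℝ (Fin n → ℝ), (W : Set (Fin n → ℝ)) ⊆ σ → W = ⊥

/-- The nonnegative orthant. -/
def orthant (n : ℕ) : Set (Fin n → ℝ) := {v | ∀ i, 0 ≤ v i}

/-- The coneTranslate `γ + σ`. -/
def coneTranslate {n : ℕ} (γ : Fin n → ℝ) (σ : Set (Fin n → ℝ)) : Set (Fin n → ℝ) :=
  {v | v - γ ∈ σ}

/-! ### Laurent series in several indeterminates -/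

/-- A formal sum `∑ ξ_a x ^ a` over integer exponent vectors `a`, with no condition on the
support; it is given by its coefficients. -/
abbrev MvLaurentSeries (n : ℕ) (K : Type*) := (Fin n → ℤ) → K

/-- The support of a Laurent series, as a set of real vectors. -/
def supp {n : ℕ} {K : Type*} [Zero K] (ξ : MvLaurentSeries n K) : Set (Fin n → ℝ) :=
  {v | ∃ a : Fin n → ℤ, ξ a ≠ 0 ∧ v = toReal a}

/-- The product of Laurent series. It is meaningful when each coefficient is a finite sum, as
happens for series supported in translates of one strongly convex polyhedral cone
(`finite_support_mul` and `supp_mul_subset` below). -/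
noncomputable def mul {n : ℕ} {K : Type*} [Field K] (ξ η : MvLaurentSeries n K) :
    MvLaurentSeries n K :=
  fun c => ∑ᶠ a : Fin n → ℤ, ξ a * η (c - a)

/-- The powers of a Laurent series. -/
noncomputable def pow {n : ℕ} {K : Type*} [Field K] (ξ : MvLaurentSeries n K) :
    ℕ → MvLaurentSeries n K
  | 0 => Pi.single 0 1
  | k + 1 => mul (pow ξ k) ξ

/-- A formal power series in `x_1, …, x_n`, seen as a Laurent series. -/
noncomputable def ofPowerSeries {n : ℕ} {K : Type*} [Field K] (f : MvPowerSeries (Fin n) K) :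
    MvLaurentSeries n K :=
  fun a =>
    if ∀ i, 0 ≤ a i then
      MvPowerSeries.coeff (Finsupp.equivFunOnFinite.symm fun i => (a i).toNat) f
    else 0

/-- The Laurent series `P(x, ξ) = ∑ k, P_k(x) ξ ^ k`, for a polynomial `P` with power series
coefficients. -/
noncomputable def evalAt {n : ℕ} {K : Type*} [Field K]
    (P : Polynomial (MvPowerSeries (Fin n) K)) (ξ : MvLaurentSeries n K) :
    MvLaurentSeries n K :=
  ∑ k ∈ P.support, mul (ofPowerSeries (P.coeff k)) (pow ξ k)

/-- `ξ` is algebraic over the field of fractions of the ring of formal power series: it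
satisfies a nonzero polynomial equation, whose denominators can be cleared so that its
coefficients are power series. -/
def IsAlgebraicOverPowerSeries {n : ℕ} {K : Type*} [Field K] (ξ : MvLaurentSeries n K) : Prop :=
  ∃ P : Polynomial (MvPowerSeries (Fin n) K), P ≠ 0 ∧ evalAt P ξ = 0

/-- The set `τ(ξ)` of all `ω` in the nonnegative orthant such that the support of `ξ` does not
meet the half-space `{u | u · ω ≤ k}` for some real `k`. -/
def tau {n : ℕ} {K : Type*} [Zero K] (ξ : MvLaurentSeries n K) : Set (Fin n → ℝ) :=
  {ω | ω ∈ orthant n ∧ ∃ k : ℝ, supp ξ ∩ {u | u ⬝ᵥ ω ≤ k} = ∅}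

/-! ### Products and powers are well defined -/

theorem add_mem_cone {n : ℕ} {s : Finset (Fin n → ℝ)} {v w : Fin n → ℝ}
    (hv : v ∈ coneGeneratedBy s) (hw : w ∈ coneGeneratedBy s) : v + w ∈ coneGeneratedBy s := by
  obtain ⟨c, hc, rfl⟩ := hv
  obtain ⟨d, hd, rfl⟩ := hw
  refine ⟨fun u => c u + d u, fun u hu => add_nonneg (hc u hu) (hd u hu), ?_⟩
  simp [add_smul, Finset.sum_add_distrib]

theorem smul_mem_cone {n : ℕ} {s : Finset (Fin n → ℝ)} {v : Fin n → ℝ} {r : ℝ} (hr : 0 ≤ r)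
    (hv : v ∈ coneGeneratedBy s) : r • v ∈ coneGeneratedBy s := by
  obtain ⟨c, hc, rfl⟩ := hv
  refine ⟨fun u => r * c u, fun u hu => mul_nonneg hr (hc u hu), ?_⟩
  simp [Finset.smul_sum, mul_smul]

theorem mem_cone_of_mem {n : ℕ} {s : Finset (Fin n → ℝ)} {v : Fin n → ℝ} (hv : v ∈ s) :
    v ∈ coneGeneratedBy s := by
  classical
  exact ⟨fun u => if u = v then 1 else 0, fun u _ => by dsimp only; split_ifs <;> simp, by simp [hv]⟩

theorem eq_zero_of_neg_mem {n : ℕ} {σ : Set (Fin n → ℝ)} (hσ : IsPolyhedralCone σ)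
    (hs : IsStronglyConvex σ) {v : Fin n → ℝ} (hv : v ∈ σ) (hv' : -v ∈ σ) : v = 0 := by
  obtain ⟨s, rfl⟩ := hσ
  have h : (Submodule.span ℝ {v} : Submodule ℝ (Fin n → ℝ)) = ⊥ := by
    refine hs _ ?_
    intro w hw
    obtain ⟨r, rfl⟩ := Submodule.mem_span_singleton.1 hw
    rcases le_total 0 r with hr | hr
    · exact smul_mem_cone hr hv
    · have := smul_mem_cone (neg_nonneg.2 hr) hv'
      simpa using this
  simpa using h

/-- In a strongly convex polyhedral cone, the decompositions of a given vector as a sum of two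
elements of the cone form a bounded set. -/
theorem exists_bound {n : ℕ} {σ : Set (Fin n → ℝ)} (hσ : IsPolyhedralCone σ)
    (hs : IsStronglyConvex σ) (d : Fin n → ℝ) :
    ∃ B : ℝ, ∀ v ∈ σ, d - v ∈ σ → ‖v‖ ≤ B := by
  obtain ⟨s, rfl⟩ := id hσ
  classical
  -- the compact image of the standard simplex on the nonzero generators
  set t := s.filter (· ≠ 0) with ht
  let f : (t → ℝ) → (Fin n → ℝ) := fun c => ∑ u : t, c u • (u : Fin n → ℝ)
  have hf : Continuous f := by fun_prop
  have hfmem : ∀ c : t → ℝ, (∀ u, 0 ≤ c u) → f c ∈ coneGeneratedBy s := by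
    intro c hc
    refine ⟨fun u => if h : u ∈ t then c ⟨u, h⟩ else 0, fun u _ => ?_, ?_⟩
    · dsimp only
      split_ifs
      · exact hc _
      · exact le_rfl
    · have h1 : ∑ u ∈ s, (if h : u ∈ t then c ⟨u, h⟩ else 0) • u
          = ∑ u ∈ t, (if h : u ∈ t then c ⟨u, h⟩ else 0) • u := by
        symm
        refine Finset.sum_subset (Finset.filter_subset _ _) ?_
        intro u _ hu
        simp [hu]
      rw [h1, ← Finset.sum_coe_sort t]
      simp [f]
  have hrep : ∀ v ∈ coneGeneratedBy s, ∃ c : t → ℝ, (∀ u, 0 ≤ c u) ∧ f c = v := by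
    rintro v ⟨c, hc, rfl⟩
    refine ⟨fun u => c u, fun u => hc _ (Finset.mem_filter.1 u.2).1, ?_⟩
    have : f (fun u => c u) = ∑ u ∈ t, c u • u := Finset.sum_coe_sort t (fun u => c u • u)
    rw [this, ht, Finset.sum_filter]
    refine Finset.sum_congr rfl fun u _ => ?_
    by_cases hu : u = 0 <;> simp [hu]
  have hne : ∀ c : t → ℝ, (∀ u, 0 ≤ c u) → f c = 0 → c = 0 := by
    intro c hc h0
    by_contra hcon
    obtain ⟨u, hu⟩ := Function.ne_iff.1 hcon
    have hpos : 0 < c u := lt_of_le_of_ne (hc u) (Ne.symm hu)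
    have hsplit : f (Function.update c u 0) + c u • (u : Fin n → ℝ) = 0 := by
      rw [← h0]
      simp only [f]
      rw [← Finset.add_sum_erase _ _ (Finset.mem_univ u),
        ← Finset.add_sum_erase (a := u) _ (fun x : t => c x • (x : Fin n → ℝ))
          (Finset.mem_univ u)]
      have : ∑ x ∈ Finset.univ.erase u, Function.update c u 0 x • (x : Fin n → ℝ)
          = ∑ x ∈ Finset.univ.erase u, c x • (x : Fin n → ℝ) := by
        refine Finset.sum_congr rfl fun x hx => ?_
        rw [Function.update_of_ne (Finset.ne_of_mem_erase hx)]
      rw [this]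
      simp [add_comm]
    have hm : f (Function.update c u 0) ∈ coneGeneratedBy s := by
      refine hfmem _ fun x => ?_
      by_cases hx : x = u
      · simp [hx]
      · simp [Function.update_of_ne hx, hc]
    have hmu : c u • (u : Fin n → ℝ) ∈ coneGeneratedBy s :=
      smul_mem_cone (hc u) (mem_cone_of_mem (Finset.mem_filter.1 u.2).1)
    have hz := eq_zero_of_neg_mem hσ hs hmu (by rwa [← eq_neg_of_add_eq_zero_left hsplit])
    rcases smul_eq_zero.1 hz with h | h
    · exact hpos.ne' h
    · exact (Finset.mem_filter.1 u.2).2 h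
  -- a uniform lower bound for the norm on the simplex
  obtain ⟨ε, hε, hεb⟩ : ∃ ε > 0, ∀ c ∈ stdSimplex ℝ t, ε ≤ ‖f c‖ := by
    rcases (stdSimplex ℝ t).eq_empty_or_nonempty with he | he
    · exact ⟨1, one_pos, by simp [he]⟩
    · obtain ⟨c, hc, hmin⟩ := (isCompact_stdSimplex ℝ t).exists_isMinOn he hf.norm.continuousOn
      refine ⟨‖f c‖, norm_pos_iff.2 fun h => ?_, fun c' hc' => hmin hc'⟩
      have := hne c hc.1 h
      have h1 := hc.2
      simp [this] at h1
  have hlin : ∀ (r : ℝ) c, f (r • c) = r • f c := by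
    intro r c
    simp [f, Finset.smul_sum, mul_smul]
  have hsum : ∀ c : t → ℝ, (∀ u, 0 ≤ c u) → (∑ u, c u) * ε ≤ ‖f c‖ := by
    intro c hc
    have hS : 0 ≤ ∑ u, c u := Finset.sum_nonneg fun u _ => hc u
    rcases hS.eq_or_lt with h | h
    · rw [← h]; simp
    · have h2 := hεb ((∑ u, c u)⁻¹ • c) ⟨fun u => by
          simpa using mul_nonneg (inv_nonneg.2 hS) (hc u), by
          simp only [Pi.smul_apply, smul_eq_mul]
          rw [← Finset.mul_sum, inv_mul_cancel₀ h.ne']⟩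
      rw [hlin, norm_smul, norm_inv, Real.norm_of_nonneg hS, inv_mul_eq_div,
        le_div_iff₀ h] at h2
      linarith
  refine ⟨(‖d‖ / ε) * ∑ u : t, ‖(u : Fin n → ℝ)‖, fun v hv hdv => ?_⟩
  obtain ⟨c, hc, rfl⟩ := hrep v hv
  obtain ⟨c', hc', hcv⟩ := hrep _ hdv
  have hd : f (c + c') = d := by
    have : f (c + c') = f c + f c' := by simp [f, add_smul, Finset.sum_add_distrib]
    rw [this, hcv]; abel
  have h3 := hsum (c + c') fun u => add_nonneg (hc u) (hc' u)
  rw [hd, ← le_div_iff₀ hε] at h3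
  calc ‖f c‖ ≤ ∑ u : t, ‖c u • (u : Fin n → ℝ)‖ := norm_sum_le _ _
    _ ≤ ∑ u : t, (‖d‖ / ε) * ‖(u : Fin n → ℝ)‖ := by
        refine Finset.sum_le_sum fun u _ => ?_
        rw [norm_smul, Real.norm_of_nonneg (hc u)]
        refine mul_le_mul_of_nonneg_right (le_trans ?_ h3) (norm_nonneg _)
        have h4 : (c + c') u ≤ ∑ u, (c + c') u :=
          Finset.single_le_sum (fun x _ => add_nonneg (hc x) (hc' x)) (Finset.mem_univ u)
        have h5 := hc' u
        simp only [Pi.add_apply] at h4 ⊢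
        linarith
    _ = _ := by rw [Finset.mul_sum]

/-- Each coefficient of a product of two series, supported in translates of one strongly convex
polyhedral cone, is a finite sum. -/
theorem finite_support_mul {n : ℕ} {K : Type*} [Field K] {σ : Set (Fin n → ℝ)}
    (hσ : IsPolyhedralCone σ) (hs : IsStronglyConvex σ) {ξ η : MvLaurentSeries n K}
    {γ δ : Fin n → ℝ} (hξ : supp ξ ⊆ coneTranslate γ σ) (hη : supp η ⊆ coneTranslate δ σ)
    (c : Fin n → ℤ) : (Function.support fun a => ξ a * η (c - a)).Finite := by
  obtain ⟨B, hB⟩ := exists_bound hσ hs (toReal c - γ - δ)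
  have hfin : (Set.univ.pi fun i : Fin n =>
      Set.Icc ⌈γ i - B⌉ ⌊γ i + B⌋ : Set (Fin n → ℤ)).Finite :=
    Set.Finite.pi fun i => Set.finite_Icc _ _
  refine hfin.subset fun a ha i _ => ?_
  have ha1 : ξ a ≠ 0 := left_ne_zero_of_mul ha
  have ha2 : η (c - a) ≠ 0 := right_ne_zero_of_mul ha
  have h1 : toReal a - γ ∈ σ := hξ ⟨a, ha1, rfl⟩
  have h2 : toReal (c - a) - δ ∈ σ := hη ⟨c - a, ha2, rfl⟩
  have h3 := hB _ h1 (by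
    convert h2 using 1
    ext j
    simp [toReal]
    ring)
  have h4 := (norm_le_pi_norm _ i).trans h3
  rw [Real.norm_eq_abs, abs_le] at h4
  simp only [Pi.sub_apply, toReal] at h4
  exact ⟨Int.ceil_le.2 (by linarith), Int.le_floor.2 (by linarith)⟩

/-- The product of such series is again supported in a coneTranslate of the cone. -/
theorem supp_mul_subset {n : ℕ} {K : Type*} [Field K] {σ : Set (Fin n → ℝ)}
    (hσ : IsPolyhedralCone σ) {ξ η : MvLaurentSeries n K}
    {γ δ : Fin n → ℝ} (hξ : supp ξ ⊆ coneTranslate γ σ) (hη : supp η ⊆ coneTranslate δ σ) :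
    supp (mul ξ η) ⊆ coneTranslate (γ + δ) σ := by
  rintro v ⟨c, hc, rfl⟩
  obtain ⟨s, rfl⟩ := hσ
  obtain ⟨a, ha⟩ : ∃ a, ξ a * η (c - a) ≠ 0 := by
    by_contra! h
    exact hc (by simp [mul, h])
  have h1 := hξ ⟨a, left_ne_zero_of_mul ha, rfl⟩
  have h2 := hη ⟨c - a, right_ne_zero_of_mul ha, rfl⟩
  have h3 := add_mem_cone h1 h2
  change toReal c - (γ + δ) ∈ coneGeneratedBy s
  convert h3 using 1
  ext j
  simp [toReal]
  ring

end LaurentCone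

/-! Write `S` for the support of `ξ`. An injective weight, positive on the nonzero generators of
`σ`, orders the exponents and places `ξ` in a field of Hahn series. Algebraicity then makes `S`
self-similar. In characteristic `p` the powers `ξ ^ p ^ i` lie in a finite extension of the fraction
field, whence a relation `∑ f_i ξ ^ p ^ i = 0`. In characteristic zero the iterates of an Euler
derivation lie in such an extension, whence a linear differential equation `∑ f_i D^i ξ = 0`. A
nonzero term of such a relation must be cancelled by another one, so `p ^ i • v + a` is also `p ^ j
• v' + a'` with `v' ∈ S`, for `v ∈ S` outside a finite set: this is `HasExchange`.

Fix an ultrafilter `U` of generic weights for which `S` is discrete. The exchange at the index `i`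
minimising `w (p ^ i • v + u i)` replaces `v` by a point of smaller weight, except at finitely many
points `W` (`descend`). Read backwards, the descent builds `v` from a least point by adding vectors
of a finitely generated cone, as long as no point of `W` is crossed; since `W` is finite, finitely
many stages exhaust `S`. Thus `S` is well quasi-ordered by a finitely generated rational cone `ρ` on
which `U`-most weights are nonnegative (`ExchangeSystem.conical`).

Then `S ⊆ B + ρ` with `B` finite, so the dual of `ρ` in the orthant lies in `τ(ξ)`. Every such
ultrafilter contains one of these duals, so by compactness finitely many of them cover all generic
weights (`exists_finite_cover`). Their union is closed, and `τ(ξ)` lies in the closure of the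
generic weights (`tau_subset_closure_genericWeights`), hence `τ(ξ)` is a finite union of rational
cones. Being convex, it is generated by all their generators. -/

namespace LaurentCone

open Filter

/-! ### Sets of lattice points that are well ordered by a cone -/

section ConeOrder

variable {V : Type*} [AddCommGroup V] [Module ℚ V]

/-- The set `E` is well quasi-ordered by the preorder `a ≤ b ↔ b - a ∈ ρ`. -/
def ConeWQO (ρ : PointedCone ℚ V) (E : Set V) : Prop :=
  E.PartiallyWellOrderedOn fun a b => b - a ∈ ρ

theorem ConeWQO.mono {ρ ρ' : PointedCone ℚ V} {E E' : Set V} (h : ConeWQO ρ E) (hρ : ρ ≤ ρ')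
    (hE : E' ⊆ E) : ConeWQO ρ' E' := by
  rw [ConeWQO, Set.partiallyWellOrderedOn_iff_exists_lt] at *
  intro f hf
  obtain ⟨m, k, hmk, h'⟩ := h f fun i => hE (hf i)
  exact ⟨m, k, hmk, hρ h'⟩

theorem ConeWQO.union {ρ : PointedCone ℚ V} {E E' : Set V} (h : ConeWQO ρ E) (h' : ConeWQO ρ E') :
    ConeWQO ρ (E ∪ E') :=
  Set.PartiallyWellOrderedOn.union h h'

/-- Otherwise elements could be chosen one after the other, none of them above an earlier one. -/
theorem ConeWQO.exists_basis {ρ : PointedCone ℚ V} {E : Set V} (h : ConeWQO ρ E) :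
    ∃ B : Finset V, (∀ b ∈ B, b ∈ E) ∧ ∀ v ∈ E, ∃ b ∈ B, v - b ∈ ρ := by
  classical
  by_contra! hcon
  obtain ⟨f, hf, hf'⟩ := exists_seq_of_forall_finset_exists (fun v => v ∈ E)
    (fun b v => v - b ∉ ρ) fun s hs => hcon s hs
  obtain ⟨m, k, hmk, h'⟩ := Set.PartiallyWellOrderedOn.exists_lt h hf
  exact hf' m k hmk h'

/-- A product of two well quasi-orders is one, and `(e, a) ↦ r • e + a` is monotone because `r ≥ 0`.
-/
theorem ConeWQO.smul_add {ρ : PointedCone ℚ V} {E A : Set V} (hE : ConeWQO ρ E)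
    (hA : ConeWQO ρ A) {r : ℚ} (hr : 0 ≤ r) :
    ConeWQO ρ {w | ∃ e ∈ E, ∃ a ∈ A, w = r • e + a} := by
  have : IsPreorder V fun a b => b - a ∈ ρ :=
    { refl := fun a => by simp
      trans := fun a b c h1 h2 => by simpa using ρ.add_mem h2 h1 }
  have h := Set.PartiallyWellOrderedOn.prod hE hA
  rw [ConeWQO, Set.partiallyWellOrderedOn_iff_exists_lt] at *
  intro f hf
  choose e he a ha hfe using hf
  obtain ⟨m, k, hmk, h1, h2⟩ := h (fun i => (e i, a i)) fun i => ⟨he i, ha i⟩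
  refine ⟨m, k, hmk, ?_⟩
  rw [hfe m, hfe k]
  have : r • e k + a k - (r • e m + a m) = r • (e k - e m) + (a k - a m) := by
    rw [smul_sub]; abel
  rw [this]
  exact ρ.add_mem (PointedCone.smul_mem ρ hr h1) h2

theorem ConeWQO.of_smul_add {ρ : PointedCone ℚ V} {E : Set V} {r : ℚ} (hr : 0 < r) (u : V)
    (h : ConeWQO ρ ((fun v => r • v + u) '' E)) : ConeWQO ρ E := by
  rw [ConeWQO, Set.partiallyWellOrderedOn_iff_exists_lt] at *
  intro f hf
  obtain ⟨m, k, hmk, h'⟩ := h (fun i => r • f i + u) fun i => ⟨f i, hf i, rfl⟩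
  refine ⟨m, k, hmk, ?_⟩
  have h2 : f k - f m = r⁻¹ • (r • f k + u - (r • f m + u)) := by
    rw [add_sub_add_right_eq_sub, ← smul_sub, inv_smul_smul₀ hr.ne']
  rw [h2]
  exact PointedCone.smul_mem ρ (inv_nonneg.2 hr.le) h'

end ConeOrder

/-- A lattice point seen as a rational vector. -/
def toRat {n : ℕ} (a : Fin n → ℤ) : Fin n → ℚ := fun i => (a i : ℚ)

theorem finite_lattice_bounded {n : ℕ} (B : ℚ) :
    {v : Fin n → ℚ | (∃ z, v = toRat z) ∧ ∀ i, |v i| ≤ B}.Finite := by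
  have h : (Set.univ.pi fun _ : Fin n => Set.Icc (-⌈B⌉) ⌈B⌉ : Set (Fin n → ℤ)).Finite :=
    Set.Finite.pi fun i => Set.finite_Icc _ _
  refine (h.image toRat).subset ?_
  rintro v ⟨⟨z, rfl⟩, hz⟩
  refine ⟨z, fun i _ => ?_, rfl⟩
  have h1 := abs_le.1 (hz i)
  have h2 := Int.le_ceil B
  simp only [toRat] at h1
  constructor
  · have : (-⌈B⌉ : ℚ) ≤ z i := by linarith
    exact_mod_cast this
  · have : (z i : ℚ) ≤ ⌈B⌉ := by linarith
    exact_mod_cast this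

theorem exists_common_denominator {n : ℕ} (G : Finset (Fin n → ℚ)) :
    ∃ d : ℕ, 0 < d ∧ ∀ g ∈ G, ∃ z, (d : ℚ) • g = toRat z := by
  classical
  refine ⟨∏ g ∈ G, ∏ i, (g i).den, Finset.prod_pos fun g _ => Finset.prod_pos fun i _ =>
    (g i).den_pos, fun g hg => ?_⟩
  have h : ∀ i, ∃ z : ℤ, ((∏ g ∈ G, ∏ i, (g i).den : ℕ) : ℚ) * g i = z := by
    intro i
    have h1 : (g i).den ∣ ∏ g ∈ G, ∏ i, (g i).den :=
      (Finset.dvd_prod_of_mem (fun i => (g i).den) (Finset.mem_univ i)).trans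
        (Finset.dvd_prod_of_mem (fun g : Fin n → ℚ => ∏ i, (g i).den) hg)
    obtain ⟨k, hk⟩ := h1
    refine ⟨k * (g i).num, ?_⟩
    rw [hk]
    push_cast
    have := Rat.den_mul_eq_num (g i)
    rw [← this]; ring
  choose z hz using h
  exact ⟨z, funext fun i => by simp [toRat, ← hz]⟩

theorem toRat_add {n : ℕ} (a b : Fin n → ℤ) : toRat (a + b) = toRat a + toRat b := by
  ext i; simp [toRat]

/-- The lattice points in a translate of a finitely generated cone are well quasi-ordered. -/
theorem coneWQO_of_subset_translate {n : ℕ} {ρ : PointedCone ℚ (Fin n → ℚ)} (hρ : ρ.FG)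
    {E : Set (Fin n → ℚ)} (hE : ∀ v ∈ E, ∃ z, v = toRat z) (c : Fin n → ℚ)
    (h : ∀ v ∈ E, v - c ∈ ρ) : ConeWQO ρ E := by
  classical
  obtain ⟨G, rfl⟩ := hρ
  obtain ⟨d, hd, hdG⟩ := exists_common_denominator G
  rw [ConeWQO, Set.partiallyWellOrderedOn_iff_exists_lt]
  intro f hf
  have hrep : ∀ k, ∃ l : (Fin n → ℚ) → NNRat, f k - c = ∑ g ∈ G, l g • g := by
    intro k
    obtain ⟨l, -, hl⟩ := Submodule.mem_span_finset.1 (h _ (hf k))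
    exact ⟨l, hl.symm⟩
  choose l hl using hrep
  -- As in Gordan's lemma, remove from each coefficient the largest possible multiple of `d`. Since
  -- `d • g` is integral, the remainder `R k` is a lattice point; it is also bounded, so it takes
  -- finitely many values. Dickson's lemma for the `N k` then gives two indices with equal
  -- remainders and `N a ≤ N b`.
  let N : ℕ → (G → ℕ) := fun k g => ⌊(l k g : ℚ) / d⌋₊
  let R : ℕ → (Fin n → ℚ) := fun k => f k - ∑ g : G, ((N k g * d : ℕ) : ℚ) • (g : Fin n → ℚ)
  have hd' : (0 : ℚ) < d := by exact_mod_cast hd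
  have hR : ∀ k, R k = c + ∑ g : G, ((l k g : ℚ) - N k g * d) • (g : Fin n → ℚ) := by
    intro k
    have h1 : f k = c + ∑ g : G, (l k g : ℚ) • (g : Fin n → ℚ) := by
      rw [eq_add_of_sub_eq' (hl k), ← Finset.sum_coe_sort G]; rfl
    simp only [R, sub_smul, Finset.sum_sub_distrib]
    rw [h1]
    push_cast
    abel
  have hRint : ∀ k, ∃ z, R k = toRat z := by
    intro k
    obtain ⟨z, hz⟩ := hE _ (hf k)
    have h2 : ∀ g : G, ∃ y, ((N k g * d : ℕ) : ℚ) • (g : Fin n → ℚ) = toRat y := by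
      intro g
      obtain ⟨y, hy⟩ := hdG g g.2
      refine ⟨fun i => N k g * y i, ?_⟩
      push_cast
      rw [mul_smul, hy]
      ext i; simp [toRat]
    choose y hy using h2
    refine ⟨z - ∑ g, y g, ?_⟩
    ext i
    simp only [R, hz, hy]
    simp [toRat]
  have hfrac : ∀ k (g : G), |(l k g : ℚ) - N k g * d| ≤ d := by
    intro k g
    have h1 : (0 : ℚ) ≤ (l k g : ℚ) / d := div_nonneg (l k g).2 hd'.le
    have h2 := Nat.floor_le h1
    have h3 := Nat.lt_floor_add_one ((l k g : ℚ) / d)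
    rw [le_div_iff₀ hd'] at h2
    rw [div_lt_iff₀ hd'] at h3
    rw [abs_le]
    simp only [N]
    constructor <;> linarith
  obtain ⟨B, hB⟩ : ∃ B : ℚ, ∀ k i, |R k i| ≤ B := by
    refine ⟨∑ i, (|c i| + ∑ g : G, d * |(g : Fin n → ℚ) i|), fun k i => ?_⟩
    have h1 : |R k i| ≤ |c i| + ∑ g : G, d * |(g : Fin n → ℚ) i| := by
      rw [hR]
      simp only [Pi.add_apply, Finset.sum_apply, Pi.smul_apply, smul_eq_mul]
      refine (abs_add_le _ _).trans (add_le_add le_rfl ?_)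
      refine (Finset.abs_sum_le_sum_abs _ _).trans (Finset.sum_le_sum fun g _ => ?_)
      rw [abs_mul]
      exact mul_le_mul_of_nonneg_right (hfrac k g) (abs_nonneg _)
    refine h1.trans (Finset.single_le_sum
      (f := fun i => |c i| + ∑ g : G, d * |(g : Fin n → ℚ) i|) (fun i _ => ?_)
      (Finset.mem_univ i))
    positivity
  have h1 := (finite_lattice_bounded (n := n) B).partiallyWellOrderedOn (r := (· = ·))
  have h2 : (Set.univ : Set (G → ℕ)).PartiallyWellOrderedOn (· ≤ ·) :=
    Set.isPWO_of_wellQuasiOrderedLE _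
  have h3 := Set.PartiallyWellOrderedOn.prod h1 h2
  rw [Set.partiallyWellOrderedOn_iff_exists_lt] at h3
  obtain ⟨a, b, hab, h4, h5⟩ := h3 (fun k => (R k, N k)) fun k => ⟨⟨hRint k, hB k⟩, trivial⟩
  refine ⟨a, b, hab, ?_⟩
  have h6 : f b - f a = ∑ g : G, (((N b g - N a g) * d : ℕ) : ℚ) • (g : Fin n → ℚ) := by
    have e1 : f b = R b + ∑ g : G, ((N b g * d : ℕ) : ℚ) • (g : Fin n → ℚ) := by simp [R]
    have e2 : f a = R a + ∑ g : G, ((N a g * d : ℕ) : ℚ) • (g : Fin n → ℚ) := by simp [R]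
    rw [e1, e2, ← show R a = R b from h4, add_sub_add_left_eq_sub, ← Finset.sum_sub_distrib]
    refine Finset.sum_congr rfl fun g _ => ?_
    rw [← sub_smul]
    congr 1
    push_cast [Nat.cast_sub (show N a g ≤ N b g from h5 g)]
    ring
  rw [h6]
  refine Submodule.sum_mem _ fun g _ => PointedCone.smul_mem _ (by positivity) ?_
  exact Submodule.subset_span g.2

end LaurentCone

namespace LaurentCone

open Filter

/-! ### Cones that are nonnegative for most weights -/

section EventuallyNonneg

variable {V : Type*} [AddCommGroup V] [Module ℚ V]

/-- Most weights, in the sense of the filter `U`, are nonnegative on the cone `ρ`. -/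
def EventuallyNonneg (U : Filter (V →ₗ[ℚ] ℝ)) (ρ : PointedCone ℚ V) : Prop :=
  ∀ᶠ w in U, ∀ g ∈ ρ, 0 ≤ w g

theorem map_nonneg_of_mem_hull {G : Set V} {w : V →ₗ[ℚ] ℝ} (h : ∀ g ∈ G, 0 ≤ w g) {v : V}
    (hv : v ∈ PointedCone.hull ℚ G) : 0 ≤ w v := by
  induction hv using Submodule.span_induction with
  | mem x hx => exact h x hx
  | zero => simp
  | add x y _ _ hx hy => rw [map_add]; exact add_nonneg hx hy
  | smul r x _ hx =>
    have : w (r • x) = (r : ℚ) • w x := w.map_smul (r : ℚ) x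
    rw [this, Rat.smul_def]
    exact mul_nonneg (by exact_mod_cast r.2) hx

theorem EventuallyNonneg.sup {U : Filter (V →ₗ[ℚ] ℝ)} {ρ ρ' : PointedCone ℚ V}
    (h : EventuallyNonneg U ρ) (h' : EventuallyNonneg U ρ') : EventuallyNonneg U (ρ ⊔ ρ') := by
  filter_upwards [h, h'] with w hw hw' g hg
  obtain ⟨a, ha, b, hb, rfl⟩ := Submodule.mem_sup.1 hg
  rw [map_add]
  exact add_nonneg (hw a ha) (hw' b hb)

theorem EventuallyNonneg.hull {U : Filter (V →ₗ[ℚ] ℝ)} (G : Finset V)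
    (h : ∀ g ∈ G, ∀ᶠ w in U, 0 ≤ w g) :
    EventuallyNonneg U (PointedCone.hull ℚ (G : Set V)) := by
  filter_upwards [(Finset.eventually_all G).2 h] with w hw v hv
  exact map_nonneg_of_mem_hull hw hv

end EventuallyNonneg

/-- A set of lattice points is conical for `U` if it is well quasi-ordered by a finitely
generated cone on which most weights are nonnegative. -/
def Conical {V : Type*} [AddCommGroup V] [Module ℚ V] (U : Filter (V →ₗ[ℚ] ℝ)) (E : Set V) : Prop :=
  ∃ ρ : PointedCone ℚ V, ρ.FG ∧ EventuallyNonneg U ρ ∧ ConeWQO ρ E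

theorem Conical.mono {V : Type*} [AddCommGroup V] [Module ℚ V] {U : Filter (V →ₗ[ℚ] ℝ)}
    {E E' : Set V} (h : Conical U E) (hE : E' ⊆ E) : Conical U E' := by
  obtain ⟨ρ, h1, h2, h3⟩ := h
  exact ⟨ρ, h1, h2, h3.mono le_rfl hE⟩

theorem Conical.union {V : Type*} [AddCommGroup V] [Module ℚ V] {U : Filter (V →ₗ[ℚ] ℝ)}
    {E E' : Set V} (h : Conical U E) (h' : Conical U E') : Conical U (E ∪ E') := by
  obtain ⟨ρ, h1, h2, h3⟩ := h
  obtain ⟨ρ', h1', h2', h3'⟩ := h'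
  exact ⟨ρ ⊔ ρ', h1.sup h1', h2.sup h2',
    (h3.mono le_sup_left le_rfl).union (h3'.mono le_sup_right le_rfl)⟩

/-- A set `S` of lattice points, discrete for most weights, with the exchange property: a sum
`p ^ i • v + u i` with `v ∈ S` outside the finite set `W` is also of another form
`p ^ j • v' + a` with `v' ∈ S` and `a ∈ A j`. The point `u i` is the least element of `A i`. -/
structure ExchangeSystem {n : ℕ} (U : Ultrafilter ((Fin n → ℚ) →ₗ[ℚ] ℝ))
    (S : Set (Fin n → ℚ)) where
  p : ℚ
  I : Finset ℕ
  A : ℕ → Set (Fin n → ℚ)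
  u : ℕ → Fin n → ℚ
  W : Finset (Fin n → ℚ)
  ρ : PointedCone ℚ (Fin n → ℚ)
  one_lt : 1 < p
  nonempty : I.Nonempty
  fg : ρ.FG
  eventuallyNonneg : EventuallyNonneg (U : Filter _) ρ
  wqo : ∀ i ∈ I, ConeWQO ρ (A i)
  sub_mem : ∀ i ∈ I, ∀ a ∈ A i, a - u i ∈ ρ
  integral : ∀ v ∈ S, ∃ z, v = toRat z
  discrete : ∀ᶠ w : (Fin n → ℚ) →ₗ[ℚ] ℝ in U,
    Function.Injective w ∧ ∀ M : ℝ, {v ∈ S | w v ≤ M}.Finite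
  -- This is the critical point `c` of the pair, where `p ^ i • c + u i = p ^ j • c + u j`.
  crit_mem : ∀ i ∈ I, ∀ j ∈ I, i ≠ j → (p ^ j - p ^ i)⁻¹ • (u i - u j) ∈ W
  exchange : ∀ i ∈ I, ∀ v ∈ S, v ∉ W → ∃ j ∈ I, ∃ a ∈ A j, ∃ v' ∈ S,
    (j, a, v') ≠ (i, u i, v) ∧ p ^ i • v + u i = p ^ j • v' + a

/-! ### Descent in an exchange system -/

namespace ExchangeSystem

variable {n : ℕ} {U : Ultrafilter ((Fin n → ℚ) →ₗ[ℚ] ℝ)} {S : Set (Fin n → ℚ)}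
  (X : ExchangeSystem U S)

include X in
-- Minimality of `i` gives `w (p ^ j • v' + a) ≤ w (p ^ j • v + u j)`, while `w a ≥ w (u j)`; hence
-- `w v' ≤ w v`. In case of equality injectivity of `w` forces `v' = v` and `a = u j`. This is the
-- excluded trivial exchange if `j = i`, and makes `v` the critical point of `(i, j)` otherwise.
theorem descend {w : (Fin n → ℚ) →ₗ[ℚ] ℝ} (hinj : Function.Injective w)
    (hw : ∀ g ∈ X.ρ, 0 ≤ w g) {v : Fin n → ℚ} (hv : v ∈ S) (hvW : v ∉ X.W) :
    ∃ i ∈ X.I, ∃ j ∈ X.I, ∃ a ∈ X.A j, ∃ v' ∈ S,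
      X.p ^ i • v + X.u i = X.p ^ j • v' + a ∧ w v' < w v ∧
      ∀ j ∈ X.I, w (X.p ^ i • v + X.u i) ≤ w (X.p ^ j • v + X.u j) := by
  obtain ⟨i, hi, hmin⟩ := X.I.exists_min_image (fun j => w (X.p ^ j • v + X.u j)) X.nonempty
  obtain ⟨j, hj, a, ha, v', hv', hne, heq⟩ := X.exchange i hi v hv hvW
  refine ⟨i, hi, j, hj, a, ha, v', hv', heq, ?_, hmin⟩
  by_contra! hlt
  have hp : (0 : ℝ) < (X.p : ℝ) ^ j := by
    have : (0 : ℝ) < X.p := by exact_mod_cast (zero_lt_one.trans X.one_lt)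
    positivity
  have e : ∀ k x, w (X.p ^ k • x) = (X.p : ℝ) ^ k * w x := by
    intro k x; rw [map_smul, Rat.smul_def]; push_cast; rfl
  have h1 := hmin j hj
  have h2 := hw _ (X.sub_mem j hj a ha)
  have h3 := congrArg w heq
  rw [map_sub] at h2
  simp only [map_add, e] at h1 h3
  have h4 := mul_le_mul_of_nonneg_left hlt hp.le
  have h5 : (X.p : ℝ) ^ j * w v' = (X.p : ℝ) ^ j * w v := by linarith
  have h6 : v' = v := hinj (mul_left_cancel₀ hp.ne' h5)
  subst h6
  have h7 : a = X.u j := hinj (by linarith)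
  subst h7
  by_cases hij : j = i
  · subst hij; exact hne rfl
  · apply hvW
    have h8 := X.crit_mem i hi j hj (Ne.symm hij)
    have h9 : X.u i - X.u j = (X.p ^ j - X.p ^ i) • v' := by
      rw [sub_smul, sub_eq_sub_iff_add_eq_add, add_comm, heq, add_comm]
    have h10 : X.p ^ j - X.p ^ i ≠ 0 := by
      rw [sub_ne_zero]
      exact fun h => hij (pow_right_injective₀ (zero_lt_one.trans X.one_lt) X.one_lt.ne' h)
    rwa [h9, inv_smul_smul₀ h10] at h8

/-- The points of `S \ E` whose exchange may lead into `E`. -/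
theorem exists_exits {E : Set (Fin n → ℚ)} {ρ : PointedCone ℚ (Fin n → ℚ)} (hρ : X.ρ ≤ ρ)
    (hE : ConeWQO ρ E) : ∃ B : Finset (Fin n → ℚ), (∀ b ∈ B, b ∈ S \ E) ∧
      ∀ i ∈ X.I, ∀ j ∈ X.I, ∀ v ∈ S \ E, ∀ a ∈ X.A j, ∀ v' ∈ E,
        X.p ^ i • v + X.u i = X.p ^ j • v' + a → ∃ b ∈ B, v - b ∈ ρ := by
  classical
  have hp : 0 < X.p := zero_lt_one.trans X.one_lt
  have key : ∀ ij : ℕ × ℕ, ij ∈ X.I ×ˢ X.I → ∃ B : Finset (Fin n → ℚ), (∀ b ∈ B, b ∈ S \ E) ∧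
      ∀ v ∈ S \ E, ∀ a ∈ X.A ij.2, ∀ v' ∈ E,
        X.p ^ ij.1 • v + X.u ij.1 = X.p ^ ij.2 • v' + a → ∃ b ∈ B, v - b ∈ ρ := by
    rintro ⟨i, j⟩ hij
    obtain ⟨hi, hj⟩ := Finset.mem_product.1 hij
    have h1 := hE.smul_add ((X.wqo j hj).mono hρ le_rfl) (pow_nonneg hp.le j)
    -- The map `v ↦ p ^ i • v + u i` reflects the order and sends `T` into `p ^ j • E + A j`, which
    -- is well quasi-ordered.
    let T := {v ∈ S \ E | ∃ e ∈ E, ∃ a ∈ X.A j, X.p ^ i • v + X.u i = X.p ^ j • e + a}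
    have h2 : ConeWQO ρ T := by
      refine ConeWQO.of_smul_add (pow_pos hp i) (X.u i) (h1.mono le_rfl ?_)
      rintro _ ⟨v, hv, rfl⟩
      exact hv.2
    obtain ⟨B, hB, hB'⟩ := h2.exists_basis
    exact ⟨B, fun b hb => (hB b hb).1, fun v hv a ha v' hv' h => hB' v ⟨hv, v', hv', a, ha, h⟩⟩
  choose! B hB hB' using key
  refine ⟨(X.I ×ˢ X.I).biUnion B, fun b hb => ?_, fun i hi j hj v hv a ha v' hv' h => ?_⟩
  · obtain ⟨ij, hij, hb⟩ := Finset.mem_biUnion.1 hb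
    exact hB ij hij b hb
  · have hij : (i, j) ∈ X.I ×ˢ X.I := Finset.mem_product.2 ⟨hi, hj⟩
    obtain ⟨b, hb, h'⟩ := hB' (i, j) hij v hv a ha v' hv' h
    exact ⟨b, Finset.mem_biUnion.2 ⟨_, hij, hb⟩, h'⟩

include X in
-- For a single weight `w`, the minimum of `S \ E` cannot descend within `S \ E`. So it lies in `W`,
-- or its exchange leads into `E`; it is then above some exit `b ∈ B` for a cone where `w ≥ 0`,
-- hence equal to `b`. The candidates form a finite set independent of `w`, and an ultrafilter
-- selects one of them.
theorem exists_least {E : Set (Fin n → ℚ)} (hE : Conical (U : Filter _) E)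
    (hne : (S \ E).Nonempty) :
    ∃ m ∈ S \ E, ∀ᶠ w : (Fin n → ℚ) →ₗ[ℚ] ℝ in U, ∀ v ∈ S \ E, w m ≤ w v := by
  classical
  obtain ⟨ρ, -, hpos, hwqo⟩ := hE
  obtain ⟨B, hB, hB'⟩ := X.exists_exits (le_sup_right : X.ρ ≤ ρ ⊔ X.ρ)
    (hwqo.mono le_sup_left le_rfl)
  have hpos' := hpos.sup X.eventuallyNonneg
  have h1 : ∀ᶠ w : (Fin n → ℚ) →ₗ[ℚ] ℝ in U, ∃ m ∈ (X.W ∪ B : Finset _),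
      m ∈ S \ E ∧ ∀ v ∈ S \ E, w m ≤ w v := by
    filter_upwards [X.discrete, X.eventuallyNonneg, hpos'] with w ⟨hinj, hfin⟩ hw hw'
    obtain ⟨v₀, hv₀⟩ := hne
    obtain ⟨m, hm, hmin⟩ := Set.exists_min_image {v ∈ S \ E | w v ≤ w v₀} w
      ((hfin (w v₀)).subset fun v hv => ⟨hv.1.1, hv.2⟩) ⟨v₀, hv₀, le_rfl⟩
    have hmin' : ∀ v ∈ S \ E, w m ≤ w v := fun v hv => by
      rcases le_total (w v) (w v₀) with h | h
      · exact hmin v ⟨hv, h⟩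
      · exact hm.2.trans h
    refine ⟨m, ?_, hm.1, hmin'⟩
    by_contra hcon
    rw [Finset.mem_union, not_or] at hcon
    obtain ⟨i, hi, j, hj, a, ha, v', hv', heq, hlt, -⟩ := X.descend hinj hw hm.1.1 hcon.1
    have hv'E : v' ∈ E := by
      by_contra h
      exact absurd (hmin' v' ⟨hv', h⟩) (not_le.2 hlt)
    obtain ⟨b, hb, hbm⟩ := hB' i hi j hj m hm.1 a ha v' hv'E heq
    have h2 := hw' _ hbm
    rw [map_sub] at h2
    have h3 : b = m := hinj (le_antisymm (by linarith) (hmin' b (hB b hb)))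
    exact hcon.2 (h3 ▸ hb)
  obtain ⟨m, -, hm⟩ := (Ultrafilter.eventually_exists_mem_iff (Finset.finite_toSet _)).1 h1
  refine ⟨m, ?_, hm.mono fun w h => h.2⟩
  obtain ⟨w, h⟩ := hm.exists
  exact h.1

/-- The points of `S \ E` below every element of `W` that exceeds `m` lie in `m + ρ`. -/
theorem exists_translate {E : Set (Fin n → ℚ)} (hE : Conical (U : Filter _) E)
    {m : Fin n → ℚ} (hm : m ∈ S \ E)
    (hmin : ∀ᶠ w : (Fin n → ℚ) →ₗ[ℚ] ℝ in U, ∀ v ∈ S \ E, w m ≤ w v) :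
    ∃ ρ : PointedCone ℚ (Fin n → ℚ), ρ.FG ∧ EventuallyNonneg (U : Filter _) ρ ∧
      ∀ᶠ w : (Fin n → ℚ) →ₗ[ℚ] ℝ in U, ∀ v ∈ S \ E,
        (∀ c ∈ X.W, (∀ᶠ w' : (Fin n → ℚ) →ₗ[ℚ] ℝ in U, w' m < w' c) → w v < w c) →
        v - m ∈ ρ := by
  classical
  obtain ⟨ρE, hfg, hpos, hwqo⟩ := hE
  obtain ⟨B, hB, hB'⟩ := X.exists_exits (le_sup_right : X.ρ ≤ ρE ⊔ X.ρ)
    (hwqo.mono le_sup_left le_rfl)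
  let above : (Fin n → ℚ) → Prop := fun c => ∀ᶠ w : (Fin n → ℚ) →ₗ[ℚ] ℝ in U, w m < w c
  have hbelow : ∀ c, ¬ above c → ∀ᶠ w : (Fin n → ℚ) →ₗ[ℚ] ℝ in U, w c ≤ w m := fun c hc =>
    (Ultrafilter.eventually_not.2 hc).mono fun w hw => not_lt.1 hw
  -- The sign of `c - m` for which `U`-most weights are nonnegative.
  let s : (Fin n → ℚ) → (Fin n → ℚ) := fun c => if above c then c - m else m - c
  let G : Finset (Fin n → ℚ) := X.W.image s ∪ B.image fun b => b - m
  have hG : ∀ g ∈ G, ∀ᶠ w : (Fin n → ℚ) →ₗ[ℚ] ℝ in U, 0 ≤ w g := by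
    intro g hg
    rcases Finset.mem_union.1 hg with hg | hg
    · obtain ⟨c, -, rfl⟩ := Finset.mem_image.1 hg
      by_cases hc : above c
      · simp only [s, if_pos hc, map_sub]
        exact hc.mono fun w hw => by linarith
      · simp only [s, if_neg hc, map_sub]
        exact (hbelow c hc).mono fun w hw => by linarith
    · obtain ⟨b, hb, rfl⟩ := Finset.mem_image.1 hg
      filter_upwards [hmin] with w hw
      have := hw b (hB b hb)
      rw [map_sub]; linarith
  let ρ : PointedCone ℚ (Fin n → ℚ) := ρE ⊔ X.ρ ⊔ PointedCone.hull ℚ (G : Set (Fin n → ℚ))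
  have hXρ : X.ρ ≤ ρ := le_sup_right.trans le_sup_left
  have hGρ : ∀ g ∈ G, g ∈ ρ := fun g hg =>
    (le_sup_right : PointedCone.hull ℚ (G : Set (Fin n → ℚ)) ≤ ρ) (Submodule.subset_span hg)
  have hp : 0 < X.p := zero_lt_one.trans X.one_lt
  refine ⟨ρ, (hfg.sup X.fg).sup ⟨G, rfl⟩, (hpos.sup X.eventuallyNonneg).sup (.hull G hG), ?_⟩
  have hW : ∀ᶠ w : (Fin n → ℚ) →ₗ[ℚ] ℝ in U, ∀ c ∈ X.W, ¬ above c → w c ≤ w m :=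
    (Finset.eventually_all _).2 fun c _ => by
      by_cases hc : above c
      · exact Eventually.of_forall fun w h => absurd hc h
      · exact (hbelow c hc).mono fun w hw _ => hw
  filter_upwards [X.discrete, X.eventuallyNonneg, hW, hmin] with w ⟨hinj, hfin⟩ hw hWw hminw
  -- Induction on the number of points of `S` of weight at most `w v`, finite by discreteness.
  have main : ∀ N : ℕ, ∀ v ∈ S \ E, (∀ c ∈ X.W, above c → w v < w c) →
      {x ∈ S | w x ≤ w v}.ncard ≤ N → v - m ∈ ρ := by
    intro N
    induction N with
    | zero =>
      intro v hv _ hN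
      rw [Nat.le_zero, Set.ncard_eq_zero (hfin _)] at hN
      exact absurd (show v ∈ {x ∈ S | w x ≤ w v} from ⟨hv.1, le_rfl⟩) (by simp [hN])
    | succ N ih =>
      intro v hv hvc hN
      by_cases hvW : v ∈ X.W
      · have h1 : ¬ above v := fun h => lt_irrefl _ (hvc v hvW h)
        have h2 : v = m := hinj (le_antisymm (hWw v hvW h1) (hminw v hv))
        simp [h2]
      obtain ⟨i, hi, j, hj, a, ha, v', hv', heq, hlt, hi'⟩ := X.descend hinj hw hv.1 hvW
      by_cases hv'E : v' ∈ E
      · obtain ⟨b, hb, hbv⟩ := hB' i hi j hj v hv a ha v' hv'E heq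
        rw [← sub_add_sub_cancel v b m]
        exact ρ.add_mem ((le_sup_left : ρE ⊔ X.ρ ≤ ρ) hbv)
          (hGρ _ (Finset.mem_union_right _ (Finset.mem_image_of_mem _ hb)))
      have hv'm : v' - m ∈ ρ := by
        refine ih v' ⟨hv', hv'E⟩ (fun c hc h => hlt.trans (hvc c hc h)) ?_
        have hss : {x ∈ S | w x ≤ w v'} ⊂ {x ∈ S | w x ≤ w v} := by
          refine ⟨fun x hx => ⟨hx.1, hx.2.trans hlt.le⟩, fun h => ?_⟩
          exact absurd (h ⟨hv.1, le_rfl⟩).2 (not_le.2 hlt)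
        have := Set.ncard_lt_ncard hss (hfin _)
        omega
      -- For the critical point `c` of `(i, j)` this vector is `(p ^ j - p ^ i) • (m - c)`.
      -- Minimality of `i` at `v` gives `(p ^ j - p ^ i) * (w v - w c) ≥ 0`. No point of `W` above
      -- `m` has weight at most `w v`, so `m` is on the same side of `c` as `v` and the sign
      -- persists at `m`.
      have hlast : (X.p ^ j - X.p ^ i) • m - (X.u i - X.u j) ∈ ρ := by
        by_cases hij : i = j
        · simp [hij]
        have hcW := X.crit_mem i hi j hj hij
        have hd : X.p ^ j - X.p ^ i ≠ 0 := by
          rw [sub_ne_zero]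
          exact fun h => hij (pow_right_injective₀ hp X.one_lt.ne' h).symm
        obtain ⟨c, hc⟩ : ∃ c, c = (X.p ^ j - X.p ^ i)⁻¹ • (X.u i - X.u j) := ⟨_, rfl⟩
        have hc' : X.u i - X.u j = (X.p ^ j - X.p ^ i) • c := by
          rw [hc, smul_inv_smul₀ hd]
        rw [← hc] at hcW
        have hsc : s c ∈ ρ := hGρ _ (Finset.mem_union_left _ (Finset.mem_image_of_mem _ hcW))
        have hcmp : 0 ≤ ((X.p ^ j - X.p ^ i : ℚ) : ℝ) * (w v - w c) := by
          have h1 := hi' j hj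
          have h2 := congrArg w hc'
          rw [map_smul, Rat.smul_def, map_sub] at h2
          simp only [map_add, map_smul, Rat.smul_def] at h1
          rw [mul_sub, ← h2]
          push_cast at h1 ⊢
          linarith
        rw [hc', ← smul_sub]
        rcases lt_or_gt_of_ne hd with hneg | hpos'
        · have hcv : w v ≤ w c := by
            have h3 : ((X.p ^ j - X.p ^ i : ℚ) : ℝ) < 0 := by exact_mod_cast hneg
            nlinarith
          have hca : above c ∨ c = m := by
            by_cases h : above c
            · exact Or.inl h
            · exact Or.inr (hinj (le_antisymm (hWw c hcW h) ((hminw v hv).trans hcv)))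
          rcases hca with hca | rfl
          · simp only [s, if_pos hca] at hsc
            have := PointedCone.smul_mem ρ (neg_nonneg.2 hneg.le) hsc
            rwa [neg_smul, ← smul_neg, neg_sub] at this
          · simp
        · have hcv : w c ≤ w v := by
            have h3 : (0 : ℝ) < ((X.p ^ j - X.p ^ i : ℚ) : ℝ) := by exact_mod_cast hpos'
            nlinarith
          have hca : ¬ above c := fun h => absurd (hvc c hcW h) (not_lt.2 hcv)
          simp only [s, if_neg hca] at hsc
          exact PointedCone.smul_mem ρ hpos'.le hsc
      have hfinal : X.p ^ i • (v - m) = X.p ^ j • (v' - m) + (a - X.u j) +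
          ((X.p ^ j - X.p ^ i) • m - (X.u i - X.u j)) := by
        have : X.p ^ i • v = X.p ^ j • v' + a - X.u i := eq_sub_of_add_eq heq
        rw [smul_sub, this, smul_sub, sub_smul]
        abel
      have hmem : X.p ^ i • (v - m) ∈ ρ := by
        rw [hfinal]
        exact ρ.add_mem (ρ.add_mem (PointedCone.smul_mem ρ (pow_pos hp j).le hv'm)
          (hXρ (X.sub_mem j hj a ha))) hlast
      have := PointedCone.smul_mem ρ (inv_nonneg.2 (pow_pos hp i).le) hmem
      rwa [inv_smul_smul₀ (pow_pos hp i).ne'] at this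
  exact fun v hv hvc => main _ v hv hvc le_rfl

include X in
-- `N` bounds the number of points of `W` that still exceed some point of `S \ E` for most weights.
-- By `exists_translate`, `E` stays conical when the points below every element of `W` above the
-- least point `m` are added. The next least point `m'` fails to be below some `c ∈ W` above `m`, so
-- this `c` leaves the count.
theorem conical_aux (N : ℕ) : ∀ E ⊆ S, Conical (U : Filter _) E →
    {c ∈ (X.W : Set (Fin n → ℚ)) | ∃ m ∈ S \ E, ∀ᶠ w : (Fin n → ℚ) →ₗ[ℚ] ℝ in U,
      w m < w c}.ncard ≤ N → Conical (U : Filter _) S := by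
  induction N using Nat.strong_induction_on with
  | _ N ih =>
    intro E hES hE hN
    rcases Set.eq_empty_or_nonempty (S \ E) with hne | hne
    · exact hE.mono (Set.sdiff_eq_empty.1 hne)
    obtain ⟨m, hm, hmin⟩ := X.exists_least hE hne
    obtain ⟨ρ, hfg, hpos, hρ⟩ := X.exists_translate hE hm hmin
    let E' : Set (Fin n → ℚ) := {v ∈ S | v ∈ E ∨ ∀ c ∈ X.W,
      (∀ᶠ w : (Fin n → ℚ) →ₗ[ℚ] ℝ in U, w m < w c) →
        ∀ᶠ w : (Fin n → ℚ) →ₗ[ℚ] ℝ in U, w v < w c}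
    have hE' : Conical (U : Filter _) E' := by
      have h1 : Conical (U : Filter _) (E' \ E) := by
        refine ⟨ρ, hfg, hpos, coneWQO_of_subset_translate hfg
          (fun v hv => X.integral v hv.1.1) m fun v hv => ?_⟩
        have h2 : ∀ᶠ w : (Fin n → ℚ) →ₗ[ℚ] ℝ in U, ∀ c ∈ X.W,
            (∀ᶠ w' : (Fin n → ℚ) →ₗ[ℚ] ℝ in U, w' m < w' c) → w v < w c :=
          (Finset.eventually_all _).2 fun c hc => by
            by_cases h : ∀ᶠ w' : (Fin n → ℚ) →ₗ[ℚ] ℝ in U, w' m < w' c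
            · exact ((hv.1.2.resolve_left hv.2) c hc h).mono fun w hw _ => hw
            · exact Eventually.of_forall fun w h' => absurd h' h
        obtain ⟨w, hw, hw'⟩ := (hρ.and h2).exists
        exact hw v ⟨hv.1.1, hv.2⟩ hw'
      refine (hE.union h1).mono fun v hv => ?_
      by_cases h : v ∈ E
      · exact Or.inl h
      · exact Or.inr ⟨hv, h⟩
    have hEE' : E ⊆ E' := fun v hv => ⟨hES hv, Or.inl hv⟩
    rcases Set.eq_empty_or_nonempty (S \ E') with hne' | hne'
    · exact hE'.mono (Set.sdiff_eq_empty.1 hne')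
    obtain ⟨m', hm', hmin'⟩ := X.exists_least hE' hne'
    have h3 : ∃ c ∈ X.W, (∀ᶠ w : (Fin n → ℚ) →ₗ[ℚ] ℝ in U, w m < w c) ∧
        ¬ ∀ᶠ w : (Fin n → ℚ) →ₗ[ℚ] ℝ in U, w m' < w c := by
      by_contra! h
      exact hm'.2 ⟨hm'.1, Or.inr fun c hc hmc => h c hc hmc⟩
    obtain ⟨c, hcW, hmc, hm'c⟩ := h3
    refine ih _ (lt_of_lt_of_le (Set.ncard_lt_ncard ⟨?_, fun h => ?_⟩
      (X.W.finite_toSet.subset fun c hc => hc.1)) hN) E' (fun v hv => hv.1) hE' le_rfl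
    · rintro c' ⟨hc', x, hx, hxc⟩
      exact ⟨hc', x, ⟨hx.1, fun h => hx.2 (hEE' h)⟩, hxc⟩
    · obtain ⟨-, x, hx, hxc⟩ := h ⟨hcW, m, hm, hmc⟩
      exact hm'c (hxc.mp (hmin'.mono fun w hw hw' => (hw x hx).trans_lt hw'))

include X in
theorem conical : Conical (U : Filter _) S :=
  X.conical_aux _ ∅ (Set.empty_subset _)
    ⟨⊥, Submodule.fg_bot, Eventually.of_forall fun w g hg => by
      rw [Submodule.mem_bot] at hg; simp [hg], Set.partiallyWellOrderedOn_empty _⟩ le_rfl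

end ExchangeSystem

end LaurentCone

namespace LaurentCone

/-! ### Linear relations in algebraic extensions -/

/-- A sequence in the field generated by an algebraic element satisfies a linear relation. -/
theorem exists_linear_relation {R L : Type*} [CommRing R] [IsDomain R] [Field L] [Algebra R L]
    (hinj : Function.Injective (algebraMap R L)) {x : L} (hx : IsAlgebraic R x) (y : ℕ → L)
    (hy : ∀ (F : Subfield L), (∀ r, algebraMap R L r ∈ F) → x ∈ F → ∀ i, y i ∈ F) :
    ∃ (s : Finset ℕ) (a : ℕ → R), ∑ i ∈ s, algebraMap R L (a i) * y i = 0 ∧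
      ∃ i ∈ s, a i ≠ 0 := by
  have : FaithfulSMul R L := (faithfulSMul_iff_algebraMap_injective R L).2 hinj
  let _ : Algebra (FractionRing R) L := FractionRing.liftAlgebra R L
  have : IsScalarTower R (FractionRing R) L := FractionRing.isScalarTower_liftAlgebra R L
  have hx' : IsIntegral (FractionRing R) x :=
    (hx.extendScalars (IsFractionRing.injective R (FractionRing R))).isIntegral
  let E := IntermediateField.adjoin (FractionRing R) {x}
  have : FiniteDimensional (FractionRing R) E := IntermediateField.adjoin.finiteDimensional hx'
  have hyE : ∀ i, y i ∈ E := hy E.toSubfield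
    (fun r => by
      rw [IsScalarTower.algebraMap_apply R (FractionRing R) L]
      exact E.algebraMap_mem _)
    (IntermediateField.mem_adjoin_simple_self _ x)
  have hdep : ¬ LinearIndependent R y := by
    rw [LinearIndependent.iff_fractionRing R (FractionRing R)]
    intro h
    have h2 : LinearIndependent (FractionRing R) (fun i => (⟨y i, hyE i⟩ : E)) :=
      LinearIndependent.of_comp E.val.toLinearMap h
    have := h2.finite
    exact not_finite ℕ
  obtain ⟨s, a, h1, h2⟩ := not_linearIndependent_iff.1 hdep
  exact ⟨s, a, by simpa only [Algebra.smul_def] using h1, h2⟩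

theorem derivation_mem_closure {L : Type*} [Field L] (D : Derivation ℤ L L) (s : Set L)
    (h : ∀ x ∈ s, D x ∈ Subfield.closure s) {x : L} (hx : x ∈ Subfield.closure s) :
    D x ∈ Subfield.closure s := by
  induction hx using Subfield.closure_induction with
  | mem x hx => exact h x hx
  | one => simp
  | add x y _ _ hx hy => rw [map_add]; exact add_mem hx hy
  | neg x _ hx => rw [map_neg]; exact neg_mem hx
  | inv x hx h =>
    rw [D.leibniz_inv, smul_eq_mul]
    exact mul_mem (neg_mem (pow_mem (inv_mem hx) 2)) h
  | mul x y hx hy h h' =>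
    rw [D.leibniz, smul_eq_mul, smul_eq_mul]
    exact add_mem (mul_mem hx h') (mul_mem hy h)

/-- In characteristic zero, a derivation that preserves `R` preserves the field generated by an
element algebraic over `R`. -/
theorem derivation_mem_of_isAlgebraic {R L : Type*} [CommRing R] [IsDomain R] [CharZero R]
    [Field L] [Algebra R L] (hinj : Function.Injective (algebraMap R L)) (D : Derivation ℤ L L)
    (hD : ∀ r, ∃ r', D (algebraMap R L r) = algebraMap R L r') {x : L} (hx : IsAlgebraic R x)
    (F : Subfield L) (hF : ∀ r, algebraMap R L r ∈ F) (hxF : x ∈ F) (i : ℕ) : D^[i] x ∈ F := by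
  classical
  let s : Set L := insert x (Set.range (algebraMap R L))
  have hxs : x ∈ Subfield.closure s := Subfield.subset_closure (Set.mem_insert _ _)
  have hrs : ∀ r, algebraMap R L r ∈ Subfield.closure s := fun r =>
    Subfield.subset_closure (Set.mem_insert_of_mem _ ⟨r, rfl⟩)
  have hsF : Subfield.closure s ≤ F := by
    rw [Subfield.closure_le]
    rintro _ (rfl | ⟨r, rfl⟩)
    · exact hxF
    · exact hF r
  have haeval : ∀ P : Polynomial R, Polynomial.aeval x P ∈ Subfield.closure s := by
    intro P
    rw [Polynomial.aeval_eq_sum_range]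
    refine sum_mem fun k _ => ?_
    rw [Algebra.smul_def]
    exact mul_mem (hrs _) (pow_mem hxs k)
  -- Chain rule; `b` collects the terms in which `D` falls on the coefficients.
  have hchain : ∀ P : Polynomial R, ∃ b ∈ Subfield.closure s,
      D (Polynomial.aeval x P) = b + Polynomial.aeval x (Polynomial.derivative P) * D x := by
    intro P
    induction P using Polynomial.induction_on' with
    | add P Q hP hQ =>
      obtain ⟨b, hb, h1⟩ := hP
      obtain ⟨c, hc, h2⟩ := hQ
      refine ⟨b + c, add_mem hb hc, ?_⟩
      rw [map_add, map_add, h1, h2, Polynomial.derivative_add, map_add]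
      ring
    | monomial k r =>
      obtain ⟨r', hr'⟩ := hD r
      refine ⟨x ^ k * algebraMap R L r', mul_mem (pow_mem hxs k) (hrs _), ?_⟩
      rw [Polynomial.aeval_monomial, D.leibniz, D.leibniz_pow, hr', Polynomial.derivative_monomial,
        Polynomial.aeval_monomial]
      simp only [smul_eq_mul, nsmul_eq_mul, map_mul, map_natCast]
      ring
  -- Take an annihilating polynomial of least degree. In characteristic zero its derivative is
  -- nonzero, and being of smaller degree it cannot vanish at `x`.
  have hsep : ∃ P : Polynomial R, Polynomial.aeval x P = 0 ∧
      Polynomial.aeval x (Polynomial.derivative P) ≠ 0 := by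
    obtain ⟨P, hP0, hPx⟩ := hx
    have hex : ∃ d, ∃ P : Polynomial R, P ≠ 0 ∧ Polynomial.aeval x P = 0 ∧ P.natDegree = d :=
      ⟨_, P, hP0, hPx, rfl⟩
    obtain ⟨Q, hQ0, hQx, hQd⟩ := Nat.find_spec hex
    refine ⟨Q, hQx, fun h => ?_⟩
    have hd : Q.natDegree ≠ 0 := by
      intro hd
      rw [Polynomial.eq_C_of_natDegree_eq_zero hd, Polynomial.aeval_C] at hQx
      have := hinj (hQx.trans (map_zero _).symm)
      exact hQ0 (by rw [Polynomial.eq_C_of_natDegree_eq_zero hd, this, Polynomial.C_0])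
    have h1 : Polynomial.derivative Q ≠ 0 := fun h0 =>
      hd (Polynomial.derivative_eq_zero.1 h0)
    have h2 := Polynomial.natDegree_derivative_lt hd
    exact Nat.find_min hex (hQd ▸ h2) ⟨_, h1, h, rfl⟩
  have hDx : D x ∈ Subfield.closure s := by
    obtain ⟨P, hP, hP'⟩ := hsep
    obtain ⟨b, hb, h⟩ := hchain P
    rw [hP, map_zero] at h
    have h2 : D x = -b / Polynomial.aeval x (Polynomial.derivative P) := by
      rw [eq_div_iff hP']
      linear_combination -h
    rw [h2]
    exact div_mem (neg_mem hb) (haeval _)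
  have hstable : ∀ y ∈ Subfield.closure s, D y ∈ Subfield.closure s := fun y hy =>
    derivation_mem_closure D s (by
      rintro _ (rfl | ⟨r, rfl⟩)
      · exact hDx
      · obtain ⟨r', hr'⟩ := hD r
        rw [hr']; exact hrs _) hy
  refine hsF ?_
  induction i with
  | zero => exact hxs
  | succ i ih => rw [Function.iterate_succ_apply']; exact hstable _ ih

/-! ### Laurent series as Hahn series -/

/-- The lattice of exponents, linearly ordered by an injective weight. -/
def WeightOrdered {n : ℕ} (w : (Fin n → ℤ) →+ ℝ) (_ : Function.Injective w) : Type :=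
  Fin n → ℤ

section Hahn

variable {n : ℕ} {w : (Fin n → ℤ) →+ ℝ} {hw : Function.Injective w}

instance : AddCommGroup (WeightOrdered w hw) :=
  inferInstanceAs (AddCommGroup (Fin n → ℤ))

noncomputable instance : LinearOrder (WeightOrdered w hw) :=
  LinearOrder.lift' (fun a : Fin n → ℤ => w a) hw

theorem WeightOrdered.le_iff {a b : WeightOrdered w hw} :
    a ≤ b ↔ w (show Fin n → ℤ from a) ≤ w (show Fin n → ℤ from b) := Iff.rfl

instance : IsOrderedAddMonoid (WeightOrdered w hw) where
  add_le_add_left a b h c := by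
    rw [WeightOrdered.le_iff] at h ⊢
    have h1 : w (show Fin n → ℤ from a + c) = w (show Fin n → ℤ from a) + w c := w.map_add a c
    have h2 : w (show Fin n → ℤ from b + c) = w (show Fin n → ℤ from b) + w c := w.map_add b c
    rw [h1, h2]
    linarith

/-- The support of `f` meets each half-space `w ≤ M` in a finite set. -/
def DiscreteFor {K : Type*} [Zero K] (w : (Fin n → ℤ) →+ ℝ) (f : MvLaurentSeries n K) : Prop :=
  ∀ M : ℝ, {a | f a ≠ 0 ∧ w a ≤ M}.Finite

theorem DiscreteFor.isPWO {K : Type*} [Zero K] {f : MvLaurentSeries n K} (hf : DiscreteFor w f) :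
    Set.IsPWO (Function.support f : Set (WeightOrdered w hw)) := by
  rw [Set.isPWO_iff_isWF, Set.isWF_iff_no_descending_seq]
  intro g hg hgs
  refine Set.infinite_range_of_injective hg.injective ((hf (w (g 0))).subset ?_)
  rintro _ ⟨k, rfl⟩
  exact ⟨hgs k, hg.antitone (Nat.zero_le k)⟩

/-- A Laurent series with discrete support as a Hahn series. -/
def toHahn {K : Type*} [Zero K] (hw : Function.Injective w) (f : MvLaurentSeries n K)
    (hf : DiscreteFor w f) : HahnSeries (WeightOrdered w hw) K :=
  ⟨f, hf.isPWO⟩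

/-- The coefficients of a Hahn series, as a Laurent series. -/
def ofHahn {K : Type*} [Zero K] (x : HahnSeries (WeightOrdered w hw) K) : MvLaurentSeries n K :=
  x.coeff

@[simp] theorem ofHahn_toHahn {K : Type*} [Zero K] (f : MvLaurentSeries n K)
    (hf : DiscreteFor w f) : ofHahn (toHahn hw f hf) = f := rfl

theorem ofHahn_injective {K : Type*} [Zero K] :
    Function.Injective (ofHahn : HahnSeries (WeightOrdered w hw) K → MvLaurentSeries n K) :=
  HahnSeries.coeff_injective

variable {K : Type*} [Field K]

theorem finite_support_ofHahn_mul (x y : HahnSeries (WeightOrdered w hw) K) (c : Fin n → ℤ) :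
    (Function.support fun a => ofHahn x a * ofHahn y (c - a)).Finite := by
  let c' : WeightOrdered w hw := c
  refine ((Finset.antidiagonal x.isPWO_support y.isPWO_support c').finite_toSet.image
    Prod.fst).subset ?_
  intro a ha
  refine ⟨(a, c' - a), ?_, rfl⟩
  rw [Finset.mem_coe, Finset.mem_antidiagonal]
  exact ⟨left_ne_zero_of_mul ha, right_ne_zero_of_mul ha, add_sub_cancel a c'⟩

theorem ofHahn_mul (x y : HahnSeries (WeightOrdered w hw) K) :
    ofHahn (x * y) = mul (ofHahn x) (ofHahn y) := by
  classical
  ext c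
  let c' : WeightOrdered w hw := c
  let T := Finset.antidiagonal x.isPWO_support y.isPWO_support c'
  let fst : WeightOrdered w hw × WeightOrdered w hw → (Fin n → ℤ) := Prod.fst
  have h1 : ∀ ij ∈ T, ij.2 = c' - ij.1 := fun ij hij =>
    eq_sub_of_add_eq' (Finset.mem_antidiagonal.1 hij).2.2
  have h2 : mul (ofHahn x) (ofHahn y) c = ∑ a ∈ T.image fst,
      ofHahn x a * ofHahn y (c - a) := by
    refine finsum_eq_sum_of_support_subset _ fun a ha => ?_
    let a' : WeightOrdered w hw := a
    refine Finset.mem_image.2 ⟨(a', c' - a'), ?_, rfl⟩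
    rw [Finset.mem_antidiagonal]
    exact ⟨left_ne_zero_of_mul ha, right_ne_zero_of_mul ha, add_sub_cancel a' c'⟩
  rw [h2, Finset.sum_image]
  · refine Finset.sum_congr rfl fun ij hij => ?_
    have := h1 ij hij
    exact congrArg (fun b => x.coeff ij.1 * y.coeff b) this
  · intro a ha b hb hab
    exact Prod.ext hab ((h1 a ha).trans ((congrArg _ hab).trans (h1 b hb).symm))

theorem ofHahn_one : ofHahn (1 : HahnSeries (WeightOrdered w hw) K) = Pi.single 0 1 := by
  ext c
  rw [Pi.single_apply]
  have h1 := HahnSeries.coeff_one (Γ := WeightOrdered w hw) (R := K) (a := c)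
  by_cases h : c = 0
  · exact h1.trans ((if_pos h).trans (if_pos h).symm)
  · exact h1.trans ((if_neg h).trans (if_neg h).symm)

theorem ofHahn_add (x y : HahnSeries (WeightOrdered w hw) K) :
    ofHahn (x + y) = ofHahn x + ofHahn y := rfl

theorem ofHahn_zero : ofHahn (0 : HahnSeries (WeightOrdered w hw) K) = 0 := rfl

/-- The coefficients, as an additive map. -/
def ofHahnHom : HahnSeries (WeightOrdered w hw) K →+ MvLaurentSeries n K where
  toFun := ofHahn
  map_zero' := rfl
  map_add' _ _ := rfl

theorem ofHahn_sum {ι : Type*} (s : Finset ι) (f : ι → HahnSeries (WeightOrdered w hw) K) :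
    ofHahn (∑ i ∈ s, f i) = ∑ i ∈ s, ofHahn (f i) :=
  map_sum (ofHahnHom (w := w) (hw := hw) (K := K)) f s

theorem ofHahn_pow (x : HahnSeries (WeightOrdered w hw) K) (k : ℕ) :
    ofHahn (x ^ k) = pow (ofHahn x) k := by
  induction k with
  | zero => rw [pow_zero, ofHahn_one]; rfl
  | succ k ih => rw [pow_succ, ofHahn_mul, ih]; rfl

/-- A tuple of natural numbers as a lattice point. -/
def natPoint {n : ℕ} (m : Fin n →₀ ℕ) : Fin n → ℤ := fun i => (m i : ℤ)

theorem natPoint_injective : Function.Injective (natPoint (n := n)) := fun _ _ h =>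
  Finsupp.ext fun i => Int.ofNat_injective (congrFun h i)

theorem natPoint_add (a b : Fin n →₀ ℕ) : natPoint (a + b) = natPoint a + natPoint b := by
  ext i; simp [natPoint]

theorem ofPowerSeries_natPoint (f : MvPowerSeries (Fin n) K) (m : Fin n →₀ ℕ) :
    ofPowerSeries f (natPoint m) = MvPowerSeries.coeff m f := by
  have h : ∀ i, 0 ≤ natPoint m i := fun i => Int.natCast_nonneg _
  rw [ofPowerSeries, if_pos h]
  congr 2
  ext i
  simp [natPoint]

theorem exists_natPoint_of_nonneg {a : Fin n → ℤ} (h : ∀ i, 0 ≤ a i) : ∃ m, natPoint m = a :=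
  ⟨Finsupp.equivFunOnFinite.symm fun i => (a i).toNat, funext fun i => by
    simp [natPoint, h i]⟩

theorem nonneg_of_ofPowerSeries_ne_zero {f : MvPowerSeries (Fin n) K} {a : Fin n → ℤ}
    (h : ofPowerSeries f a ≠ 0) : ∀ i, 0 ≤ a i := by
  by_contra hcon
  exact h (if_neg hcon)

theorem ofPowerSeries_injective :
    Function.Injective (ofPowerSeries : MvPowerSeries (Fin n) K → MvLaurentSeries n K) := by
  intro f g h
  ext m
  rw [← ofPowerSeries_natPoint, ← ofPowerSeries_natPoint, h]

theorem ofPowerSeries_ext {f : MvPowerSeries (Fin n) K} {g : MvLaurentSeries n K}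
    (h : ∀ m, g (natPoint m) = MvPowerSeries.coeff m f)
    (h' : ∀ a, (¬ ∀ i, 0 ≤ a i) → g a = 0) : ofPowerSeries f = g := by
  ext a
  by_cases ha : ∀ i, 0 ≤ a i
  · obtain ⟨m, rfl⟩ := exists_natPoint_of_nonneg ha
    rw [ofPowerSeries_natPoint, h]
  · rw [h' a ha, ofPowerSeries, if_neg ha]

theorem ofPowerSeries_mul (f g : MvPowerSeries (Fin n) K) :
    ofPowerSeries (f * g) = mul (ofPowerSeries f) (ofPowerSeries g) := by
  classical
  refine ofPowerSeries_ext (fun m => ?_) fun c hc => ?_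
  · rw [MvPowerSeries.coeff_mul]
    have h2 : mul (ofPowerSeries f) (ofPowerSeries g) (natPoint m) =
        ∑ a ∈ (Finset.HasAntidiagonal.antidiagonal m).image fun ij => natPoint ij.1,
          ofPowerSeries f a * ofPowerSeries g (natPoint m - a) := by
      refine finsum_eq_sum_of_support_subset _ fun a ha => ?_
      obtain ⟨i, rfl⟩ := exists_natPoint_of_nonneg
        (nonneg_of_ofPowerSeries_ne_zero (left_ne_zero_of_mul ha))
      obtain ⟨j, hj⟩ := exists_natPoint_of_nonneg
        (nonneg_of_ofPowerSeries_ne_zero (right_ne_zero_of_mul ha))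
      refine Finset.mem_image.2 ⟨(i, j), ?_, rfl⟩
      rw [Finset.HasAntidiagonal.mem_antidiagonal]
      apply natPoint_injective
      rw [natPoint_add, hj, add_sub_cancel]
    rw [h2, Finset.sum_image]
    · refine Finset.sum_congr rfl fun ij hij => ?_
      rw [← Finset.HasAntidiagonal.mem_antidiagonal.1 hij, natPoint_add, add_sub_cancel_left,
        ofPowerSeries_natPoint, ofPowerSeries_natPoint]
    · intro a ha b hb hab
      have h1 := natPoint_injective hab
      have ha' := Finset.HasAntidiagonal.mem_antidiagonal.1 ha
      have hb' := Finset.HasAntidiagonal.mem_antidiagonal.1 hb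
      rw [← hb', ← h1] at ha'
      exact Prod.ext h1 (add_left_cancel ha')
  · refine finsum_eq_zero_of_forall_eq_zero fun a => ?_
    by_contra h
    refine hc fun i => ?_
    have h1 := nonneg_of_ofPowerSeries_ne_zero (left_ne_zero_of_mul h) i
    have h2 := nonneg_of_ofPowerSeries_ne_zero (right_ne_zero_of_mul h) i
    simp only [Pi.sub_apply] at h2
    linarith

theorem ofPowerSeries_one :
    ofPowerSeries (1 : MvPowerSeries (Fin n) K) = Pi.single 0 1 := by
  classical
  refine ofPowerSeries_ext (fun m => ?_) fun a ha => ?_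
  · rw [MvPowerSeries.coeff_one, Pi.single_apply]
    refine if_congr ⟨fun h => natPoint_injective (h.trans ?_), fun h => ?_⟩ rfl rfl
    · ext i; simp [natPoint]
    · rw [h]; ext i; simp [natPoint]
  · rw [Pi.single_apply, if_neg]
    rintro rfl
    exact ha fun i => le_rfl

theorem ofPowerSeries_zero : ofPowerSeries (0 : MvPowerSeries (Fin n) K) = 0 :=
  ofPowerSeries_ext (fun m => by simp) fun a _ => rfl

theorem ofPowerSeries_add (f g : MvPowerSeries (Fin n) K) :
    ofPowerSeries (f + g) = ofPowerSeries f + ofPowerSeries g := by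
  refine ofPowerSeries_ext (fun m => ?_) fun a ha => ?_
  · rw [Pi.add_apply, ofPowerSeries_natPoint, ofPowerSeries_natPoint, map_add]
  · simp only [Pi.add_apply, ofPowerSeries, if_neg ha, add_zero]

theorem weight_eq_sum (w : (Fin n → ℤ) →+ ℝ) (a : Fin n → ℤ) :
    w a = ∑ i, (a i : ℝ) * w (Pi.single i 1) := by
  conv_lhs => rw [← Finset.univ_sum_single a]
  rw [map_sum]
  refine Finset.sum_congr rfl fun i _ => ?_
  have : (Pi.single i (a i) : Fin n → ℤ) = a i • Pi.single i 1 := by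
    rw [← Pi.single_smul]; simp
  rw [this, map_zsmul, zsmul_eq_mul]

theorem discreteFor_ofPowerSeries (hpos : ∀ i, 0 < w (Pi.single i 1))
    (f : MvPowerSeries (Fin n) K) : DiscreteFor w (ofPowerSeries f) := by
  intro M
  have hfin : (Set.univ.pi fun i : Fin n =>
      Set.Icc 0 ⌊M / w (Pi.single i 1)⌋ : Set (Fin n → ℤ)).Finite :=
    Set.Finite.pi fun i => Set.finite_Icc _ _
  refine hfin.subset fun a ha i _ => ⟨nonneg_of_ofPowerSeries_ne_zero ha.1 i, ?_⟩
  have h0 := nonneg_of_ofPowerSeries_ne_zero ha.1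
  rw [Int.le_floor, le_div_iff₀ (hpos i)]
  refine le_trans ?_ ha.2
  rw [weight_eq_sum w a]
  exact Finset.single_le_sum (f := fun i => (a i : ℝ) * w (Pi.single i 1))
    (fun j _ => mul_nonneg (by exact_mod_cast h0 j) (hpos j).le) (Finset.mem_univ i)

/-- The embedding of power series into Hahn series. -/
noncomputable def powerSeriesToHahn (hw : Function.Injective w)
    (hpos : ∀ i, 0 < w (Pi.single i 1)) :
    MvPowerSeries (Fin n) K →+* HahnSeries (WeightOrdered w hw) K where
  toFun f := toHahn hw (ofPowerSeries f) (discreteFor_ofPowerSeries hpos f)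
  map_one' := ofHahn_injective (by rw [ofHahn_toHahn, ofPowerSeries_one, ofHahn_one])
  map_mul' _ _ := ofHahn_injective (by
    rw [ofHahn_mul, ofHahn_toHahn, ofHahn_toHahn, ofHahn_toHahn, ofPowerSeries_mul])
  map_zero' := ofHahn_injective (by rw [ofHahn_toHahn, ofPowerSeries_zero, ofHahn_zero])
  map_add' _ _ := ofHahn_injective (by
    rw [ofHahn_add, ofHahn_toHahn, ofHahn_toHahn, ofHahn_toHahn, ofPowerSeries_add])

@[simp] theorem ofHahn_powerSeriesToHahn (hpos : ∀ i, 0 < w (Pi.single i 1))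
    (f : MvPowerSeries (Fin n) K) : ofHahn (powerSeriesToHahn hw hpos f) = ofPowerSeries f := rfl

theorem powerSeriesToHahn_injective (hpos : ∀ i, 0 < w (Pi.single i 1)) :
    Function.Injective (powerSeriesToHahn (K := K) hw hpos) := fun _ _ h =>
  ofPowerSeries_injective (congrArg ofHahn h)

theorem ofHahn_eval₂ (hpos : ∀ i, 0 < w (Pi.single i 1))
    (P : Polynomial (MvPowerSeries (Fin n) K)) (x : HahnSeries (WeightOrdered w hw) K) :
    ofHahn (P.eval₂ (powerSeriesToHahn hw hpos) x) = evalAt P (ofHahn x) := by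
  rw [Polynomial.eval₂_eq_sum, Polynomial.sum, ofHahn_sum]
  refine Finset.sum_congr rfl fun k _ => ?_
  rw [ofHahn_mul, ofHahn_pow, ofHahn_powerSeriesToHahn]

end Hahn

end LaurentCone

namespace LaurentCone

section Exchange

variable {n : ℕ} {w : (Fin n → ℤ) →+ ℝ} {hw : Function.Injective w} {K : Type*} [Field K]

/-! ### Frobenius powers -/

/-- A term of weight at most `(k + 1) * M` in `x ^ k * x` has a factor of weight at most `k * M` on
the left, or at most `M` on the right. -/
theorem ofHahn_pow_eq_zero (x : HahnSeries (WeightOrdered w hw) K) (M : ℝ)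
    (hx : ∀ a, w a ≤ M → ofHahn x a = 0) {k : ℕ} (hk : 1 ≤ k) :
    ∀ a, w a ≤ k * M → ofHahn (x ^ k) a = 0 := by
  induction k, hk using Nat.le_induction with
  | base => simpa using hx
  | succ k hk ih =>
    intro c hc
    rw [pow_succ, ofHahn_mul]
    refine finsum_eq_zero_of_forall_eq_zero fun a => ?_
    rcases le_or_gt (w a) (k * M) with h | h
    · rw [ih a h, zero_mul]
    · rw [hx (c - a), mul_zero]
      rw [map_sub]
      push_cast at hc
      linarith

theorem ofHahn_single (a : Fin n → ℤ) (r : K) :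
    ofHahn (HahnSeries.single (show WeightOrdered w hw from a) r) = Pi.single a r := by
  classical
  ext b
  rw [Pi.single_apply]
  have h1 := HahnSeries.coeff_single (Γ := WeightOrdered w hw) (a := a) (b := b) (r := r)
  by_cases h : b = a
  · exact h1.trans ((if_pos h).trans (if_pos h).symm)
  · exact h1.trans ((if_neg h).trans (if_neg h).symm)

/-- In characteristic `p`, the power `x ^ q` for `q` a power of `p` is computed termwise. -/
theorem ofHahn_frobenius (p : ℕ) [Fact p.Prime] [CharP K p] (x : HahnSeries (WeightOrdered w hw) K)
    (hx : DiscreteFor w (ofHahn x)) (k : ℕ) (b : Fin n → ℤ) :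
    (∀ a, p ^ k • a = b → ofHahn (x ^ p ^ k) b = ofHahn x a ^ p ^ k) ∧
    ((∀ a, p ^ k • a ≠ b) → ofHahn (x ^ p ^ k) b = 0) := by
  classical
  have : CharP (HahnSeries (WeightOrdered w hw) K) p :=
    charP_of_injective_ringHom (HahnSeries.C_injective (Γ := WeightOrdered w hw) (R := K)) p
  set q := p ^ k with hq
  have hq1 : 1 ≤ q := Nat.one_le_pow _ _ (Fact.out : p.Prime).pos
  have hq0 : (0 : ℝ) < q := by exact_mod_cast hq1
  -- Truncate `x` at this weight. Only finitely many monomials remain, whose sum is raised to the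
  -- power `q` termwise, and the `q`-th power of the rest has no coefficient at `b`.
  let M : ℝ := w b / q
  let F := (hx M).toFinset
  let z : HahnSeries (WeightOrdered w hw) K :=
    ∑ a ∈ F, HahnSeries.single (show WeightOrdered w hw from a) (ofHahn x a)
  have hz : ∀ a, ofHahn z a = if a ∈ F then ofHahn x a else 0 := by
    intro a
    simp only [z, ofHahn_sum, ofHahn_single, Finset.sum_apply, Pi.single_apply]
    rw [Finset.sum_ite_eq]
  have hr : ∀ a, w a ≤ M → ofHahn (x - z) a = 0 := by
    intro a ha
    have h1 : ofHahn (x - z) a = ofHahn x a - ofHahn z a := rfl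
    rw [h1, hz]
    split_ifs with h
    · exact sub_self _
    · rw [sub_zero]
      by_contra hne
      exact h ((hx M).mem_toFinset.2 ⟨hne, ha⟩)
  have h1 : x ^ q = z ^ q + (x - z) ^ q := by
    rw [hq, ← add_pow_char_pow, add_sub_cancel]
  have h2 : ofHahn (x ^ q) b = ∑ a ∈ F, if b = q • a then ofHahn x a ^ q else 0 := by
    rw [h1, ofHahn_add, Pi.add_apply,
      ofHahn_pow_eq_zero _ M hr hq1 b (by simp only [M]; rw [mul_div_cancel₀ _ hq0.ne']), add_zero]
    simp only [z]
    rw [hq, sum_pow_char_pow, ofHahn_sum, Finset.sum_apply]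
    refine Finset.sum_congr rfl fun a _ => ?_
    refine (congrFun (congrArg ofHahn (HahnSeries.single_pow (Γ := WeightOrdered w hw) a (p ^ k)
      (ofHahn x a))) b).trans ?_
    have h3 := congrFun (ofHahn_single (w := w) (hw := hw) (p ^ k • a) (ofHahn x a ^ p ^ k)) b
    rw [Pi.single_apply] at h3
    exact h3
  have hinj : ∀ a a' : Fin n → ℤ, q • a = q • a' → a = a' := fun a a' h =>
    smul_right_injective _ (Nat.one_le_iff_ne_zero.1 hq1) h
  refine ⟨fun a ha => ?_, fun h => ?_⟩
  · rw [h2]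
    have h4 : ∀ a' ∈ F, (if b = q • a' then ofHahn x a' ^ q else 0) =
        if a = a' then ofHahn x a' ^ q else 0 := fun a' _ =>
      if_congr ⟨fun h => hinj _ _ (ha.trans h), fun h => h ▸ ha.symm⟩ rfl rfl
    rw [Finset.sum_congr rfl h4, Finset.sum_ite_eq]
    split_ifs with haF
    · rfl
    · have h5 : w a ≤ M := by
        rw [le_div_iff₀ hq0, ← ha, map_nsmul, nsmul_eq_mul, mul_comm]
      have h6 : ofHahn x a = 0 := by
        by_contra hne
        exact haF ((hx M).mem_toFinset.2 ⟨hne, h5⟩)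
      rw [h6, zero_pow (Nat.one_le_iff_ne_zero.1 hq1)]
  · rw [h2]
    exact Finset.sum_eq_zero fun a _ => if_neg fun h' => h a h'.symm

/-! ### Euler derivations -/

/-- The derivation that multiplies `x ^ a` by `D a`. -/
noncomputable def eulerDerivation (D : (Fin n → ℤ) →+ K) :
    Derivation ℤ (HahnSeries (WeightOrdered w hw) K) (HahnSeries (WeightOrdered w hw) K) :=
  let T : HahnSeries (WeightOrdered w hw) K →+ HahnSeries (WeightOrdered w hw) K :=
    { toFun := fun x => ⟨fun a => D a * x.coeff a,
        x.isPWO_support.mono fun _ ha => right_ne_zero_of_mul ha⟩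
      map_zero' := HahnSeries.ext (funext fun a => mul_zero (D a))
      map_add' := fun x y => HahnSeries.ext (funext fun a => mul_add (D a) _ _) }
  Derivation.mk' T.toIntLinearMap fun x y => by
    apply ofHahn_injective
    ext c
    have hT : ∀ x a, ofHahn (T x) a = D a * ofHahn x a := fun x a => rfl
    have h1 : ofHahn (x • T y + y • T x) c = ofHahn (x * T y) c + ofHahn (T x * y) c := by
      rw [mul_comm (T x) y]; rfl
    refine Eq.trans ?_ h1.symm
    change ofHahn (T (x * y)) c = _
    rw [hT, ofHahn_mul, ofHahn_mul, ofHahn_mul]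
    simp only [mul]
    rw [mul_finsum,
      ← finsum_add_distrib (finite_support_ofHahn_mul x (T y) c)
        (finite_support_ofHahn_mul (T x) y c)]
    refine finsum_congr fun a => ?_
    rw [hT, hT, map_sub]
    ring

theorem ofHahn_eulerDerivation (D : (Fin n → ℤ) →+ K) (x : HahnSeries (WeightOrdered w hw) K)
    (a : Fin n → ℤ) : ofHahn (eulerDerivation D x) a = D a * ofHahn x a := rfl

theorem ofHahn_iterate_eulerDerivation (D : (Fin n → ℤ) →+ K)
    (x : HahnSeries (WeightOrdered w hw) K) (i : ℕ) (a : Fin n → ℤ) :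
    ofHahn ((eulerDerivation D)^[i] x) a = D a ^ i * ofHahn x a := by
  induction i with
  | zero => simp
  | succ i ih => rw [Function.iterate_succ_apply', ofHahn_eulerDerivation, ih]; ring

theorem eulerDerivation_powerSeriesToHahn (hpos : ∀ i, 0 < w (Pi.single i 1))
    (D : (Fin n → ℤ) →+ K) (f : MvPowerSeries (Fin n) K) :
    ∃ g, eulerDerivation D (powerSeriesToHahn hw hpos f) = powerSeriesToHahn hw hpos g := by
  let g : MvPowerSeries (Fin n) K := fun m => D (natPoint m) * MvPowerSeries.coeff m f
  refine ⟨g, ofHahn_injective ?_⟩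
  rw [ofHahn_powerSeriesToHahn]
  symm
  refine ofPowerSeries_ext (fun m => ?_) fun a ha => ?_
  · rw [ofHahn_eulerDerivation, ofHahn_powerSeriesToHahn, ofPowerSeries_natPoint]
    rfl
  · rw [ofHahn_eulerDerivation, ofHahn_powerSeriesToHahn, ofPowerSeries, if_neg ha, mul_zero]

/-! ### The exchange property of the support of an algebraic series -/

/-- Every sum `p ^ i • v + a`, with `a ∈ A i` and `v ∈ S` outside of a finite set, is of another
form `p ^ j • v' + a'` with `a' ∈ A j` and `v' ∈ S`. -/
def HasExchange (S : Set (Fin n → ℤ)) : Prop :=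
  ∃ (p : ℕ) (I : Finset ℕ) (A : ℕ → Set (Fin n → ℤ)), 1 < p ∧ I.Nonempty ∧
    (∀ i ∈ I, (A i).Nonempty ∧ ∀ a ∈ A i, ∀ k, 0 ≤ a k) ∧
    ∀ i ∈ I, ∀ a ∈ A i, ∃ W : Finset (Fin n → ℤ), ∀ v ∈ S, v ∉ W →
      ∃ j ∈ I, ∃ a' ∈ A j, ∃ v' ∈ S, (j, a', v') ≠ (i, a, v) ∧ p ^ i • v + a = p ^ j • v' + a'

theorem exists_ne_of_finsum_eq_zero {ι α : Type*} {s : Finset ι} {g : ι → α → K}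
    (h : ∑ i ∈ s, ∑ᶠ a, g i a = 0) {i : ι}
    (hi : i ∈ s) {a : α} (ha : g i a ≠ 0) :
    ∃ j ∈ s, ∃ b, (j, b) ≠ (i, a) ∧ g j b ≠ 0 := by
  classical
  by_contra! hcon
  have h1 : ∀ j ∈ s, j ≠ i → ∑ᶠ b, g j b = 0 := fun j hj hji =>
    finsum_eq_zero_of_forall_eq_zero fun b => hcon j hj b fun h => hji (congrArg Prod.fst h)
  have h2 : ∑ᶠ b, g i b = g i a := by
    refine finsum_eq_single _ a fun b hb => hcon i hi b fun h => hb (congrArg Prod.snd h)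
  rw [Finset.sum_eq_single_of_mem i hi h1, h2] at h
  exact ha h

/-- Take the coefficient at `c = p ^ i • v + a` in `∑ f_i ξ ^ p ^ i = 0`. Its nonzero terms
correspond to the ways of writing `c = p ^ j • v' + a'` with `a'` in the support of `f_j` and `v' ∈
S`, so there cannot be exactly one. -/
theorem hasExchange_of_charP (p : ℕ) [Fact p.Prime] [CharP K p] (hw : Function.Injective w)
    (hpos : ∀ i, 0 < w (Pi.single i 1)) {ξ : MvLaurentSeries n K} (hξ : DiscreteFor w ξ)
    (halg : IsAlgebraicOverPowerSeries ξ) : HasExchange {a | ξ a ≠ 0} := by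
  classical
  obtain ⟨P, hP0, hP⟩ := halg
  let x := toHahn hw ξ hξ
  let _ : Algebra (MvPowerSeries (Fin n) K) (HahnSeries (WeightOrdered w hw) K) :=
    (powerSeriesToHahn hw hpos).toAlgebra
  have : IsDomain (MvPowerSeries (Fin n) K) := (powerSeriesToHahn_injective (hw := hw) hpos).isDomain
  have hx : IsAlgebraic (MvPowerSeries (Fin n) K) x :=
    ⟨P, hP0, ofHahn_injective ((ofHahn_eval₂ hpos P x).trans hP)⟩
  obtain ⟨s, f, hsum, i₀, hi₀, hfi₀⟩ := exists_linear_relation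
    (powerSeriesToHahn_injective hpos) hx (fun i => x ^ p ^ i) fun F _ h i => pow_mem h _
  have hp : p.Prime := Fact.out
  refine ⟨p, s.filter fun i => f i ≠ 0, fun i => {a | ofPowerSeries (f i) a ≠ 0}, hp.one_lt,
    ⟨i₀, Finset.mem_filter.2 ⟨hi₀, hfi₀⟩⟩, fun i hi => ⟨?_, fun a ha =>
      nonneg_of_ofPowerSeries_ne_zero ha⟩, fun i hi a ha => ⟨∅, fun v hv _ => ?_⟩⟩
  · by_contra hcon
    rw [Set.not_nonempty_iff_eq_empty, Set.eq_empty_iff_forall_notMem] at hcon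
    refine (Finset.mem_filter.1 hi).2 (ofPowerSeries_injective ?_)
    rw [ofPowerSeries_zero]
    exact funext fun a => not_not.1 (hcon a)
  · let c := p ^ i • v + a
    let g : ℕ → (Fin n → ℤ) → K := fun j b => ofPowerSeries (f j) b * ofHahn (x ^ p ^ j) (c - b)
    have h0 : ∑ j ∈ s, ∑ᶠ b, g j b = 0 := by
      have := congrFun (congrArg ofHahn hsum) c
      rw [ofHahn_sum, Finset.sum_apply, ofHahn_zero] at this
      rw [Pi.zero_apply] at this
      rw [← this]
      refine Finset.sum_congr rfl fun j _ => ?_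
      rw [ofHahn_mul]
      rfl
    have hga : g i a ≠ 0 := by
      refine mul_ne_zero ha ?_
      rw [(ofHahn_frobenius p x hξ i (c - a)).1 v (by simp [c])]
      exact pow_ne_zero _ hv
    obtain ⟨j, hj, b, hne, hgb⟩ := exists_ne_of_finsum_eq_zero h0
      (Finset.mem_filter.1 hi).1 hga
    have hfj : f j ≠ 0 := by
      intro h
      apply left_ne_zero_of_mul hgb
      rw [h, ofPowerSeries_zero]; rfl
    obtain ⟨v', hv'⟩ : ∃ v', p ^ j • v' = c - b := by
      by_contra! h
      exact right_ne_zero_of_mul hgb ((ofHahn_frobenius p x hξ j (c - b)).2 h)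
    refine ⟨j, Finset.mem_filter.2 ⟨hj, hfj⟩, b, left_ne_zero_of_mul hgb, v', ?_, ?_, ?_⟩
    · intro h
      have h1 := right_ne_zero_of_mul hgb
      rw [(ofHahn_frobenius p x hξ j (c - b)).1 v' hv'] at h1
      exact h1 (by
        rw [show ofHahn x v' = 0 from h, zero_pow (pow_ne_zero _ hp.ne_zero)])
    · intro h
      rw [Prod.mk.injEq, Prod.mk.injEq] at h
      exact hne (Prod.ext h.1 h.2.1)
    · rw [hv', sub_add_cancel]

/-- On coefficients, `∑ f_i D^i ξ = 0` reads `∑ Q_a(D(c - a)) ξ_{c - a} = 0`, where the polynomial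
`Q_a` collects the coefficients of the `f_i` at `x ^ a`. As `D` is injective, `Q_a(D v)` vanishes
for finitely many `v` only; these are the exceptions. -/
theorem hasExchange_of_charZero [CharZero K] (hw : Function.Injective w)
    (hpos : ∀ i, 0 < w (Pi.single i 1)) (D : (Fin n → ℤ) →+ K) (hD : Function.Injective D)
    {ξ : MvLaurentSeries n K} (hξ : DiscreteFor w ξ)
    (halg : IsAlgebraicOverPowerSeries ξ) : HasExchange {a | ξ a ≠ 0} := by
  classical
  obtain ⟨P, hP0, hP⟩ := halg
  let x := toHahn hw ξ hξ
  let _ : Algebra (MvPowerSeries (Fin n) K) (HahnSeries (WeightOrdered w hw) K) :=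
    (powerSeriesToHahn hw hpos).toAlgebra
  have : IsDomain (MvPowerSeries (Fin n) K) := (powerSeriesToHahn_injective (hw := hw) hpos).isDomain
  have hx : IsAlgebraic (MvPowerSeries (Fin n) K) x :=
    ⟨P, hP0, ofHahn_injective ((ofHahn_eval₂ hpos P x).trans hP)⟩
  have : CharZero (MvPowerSeries (Fin n) K) :=
    charZero_of_injective_ringHom (f := MvPowerSeries.C) MvPowerSeries.C_injective
  obtain ⟨s, f, hsum, i₀, hi₀, hfi₀⟩ := exists_linear_relation
    (powerSeriesToHahn_injective hpos) hx (fun i => (eulerDerivation D)^[i] x)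
    fun F hF h i => derivation_mem_of_isAlgebraic (powerSeriesToHahn_injective hpos)
      (eulerDerivation D) (eulerDerivation_powerSeriesToHahn hpos D) hx F hF h i
  let Q : (Fin n → ℤ) → Polynomial K := fun a =>
    ∑ i ∈ s, Polynomial.monomial i (ofPowerSeries (f i) a)
  have hQ : ∀ a i, i ∈ s → (Q a).coeff i = ofPowerSeries (f i) a := by
    intro a i hi
    simp only [Q, Polynomial.finsetSum_coeff, Polynomial.coeff_monomial]
    rw [Finset.sum_ite_eq' s i (fun i => ofPowerSeries (f i) a), if_pos hi]
  have hQne : ∀ a, Q a ≠ 0 → ∃ i ∈ s, ofPowerSeries (f i) a ≠ 0 := by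
    intro a ha
    by_contra! h
    exact ha (Finset.sum_eq_zero fun i hi => by rw [h i hi, Polynomial.monomial_zero_right])
  have hrec : ∀ c, ∑ᶠ a, (Q a).eval (D (c - a)) * ξ (c - a) = 0 := by
    intro c
    have h1 := congrFun (congrArg ofHahn hsum) c
    rw [ofHahn_sum, Finset.sum_apply, ofHahn_zero, Pi.zero_apply] at h1
    rw [← h1]
    have h2 : ∀ i ∈ s, ofHahn (algebraMap _ _ (f i) * (eulerDerivation D)^[i] x) c =
        ∑ᶠ a, ofPowerSeries (f i) a * (D (c - a) ^ i * ξ (c - a)) := by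
      intro i _
      rw [ofHahn_mul]
      refine finsum_congr fun a => ?_
      rw [ofHahn_iterate_eulerDerivation]
      rfl
    rw [Finset.sum_congr rfl h2, ← finsum_sum_comm]
    · refine finsum_congr fun a => ?_
      simp only [Q, Polynomial.eval_finsetSum, Polynomial.eval_monomial, Finset.sum_mul, mul_assoc]
    · intro i _
      refine (finite_support_ofHahn_mul (algebraMap _ _ (f i)) ((eulerDerivation D)^[i] x) c).subset
        fun a ha => ?_
      have h3 := ofHahn_iterate_eulerDerivation D x i (c - a)
      rw [Function.mem_support, h3]
      exact ha
  -- With `0` as the only index every `p ^ i` is `1`; the value `2` only has to exceed `1`.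
  refine ⟨2, {0}, fun _ => {a | Q a ≠ 0}, one_lt_two, Finset.singleton_nonempty 0,
    fun i _ => ⟨?_, fun a ha => ?_⟩, fun i hi a ha => ?_⟩
  · by_contra hcon
    rw [Set.not_nonempty_iff_eq_empty, Set.eq_empty_iff_forall_notMem] at hcon
    refine hfi₀ (ofPowerSeries_injective ?_)
    rw [ofPowerSeries_zero]
    ext a
    rw [← hQ a i₀ hi₀, not_not.1 (hcon a)]
    rfl
  · obtain ⟨i, -, hi⟩ := hQne a ha
    exact nonneg_of_ofPowerSeries_ne_zero hi
  · refine ⟨(Q a).roots.toFinset.preimage D hD.injOn, fun v hv hvW => ?_⟩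
    rw [Finset.mem_preimage, Multiset.mem_toFinset, Polynomial.mem_roots ha,
      Polynomial.IsRoot] at hvW
    have hex : ∃ b, b ≠ a ∧ (Q b).eval (D (v + a - b)) * ξ (v + a - b) ≠ 0 := by
      by_contra! hcon
      have h1 := hrec (v + a)
      rw [finsum_eq_single _ a fun b hb => hcon b hb, add_sub_cancel_right] at h1
      exact mul_ne_zero hvW hv h1
    obtain ⟨b, hba, hb⟩ := hex
    refine ⟨0, Finset.mem_singleton_self 0, b, fun h => left_ne_zero_of_mul hb (by
      rw [h, Polynomial.eval_zero]), v + a - b, right_ne_zero_of_mul hb,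
      fun h => hba (congrArg (fun t => t.2.1) h), ?_⟩
    rw [Finset.mem_singleton.1 hi]
    simp

end Exchange

end LaurentCone

namespace LaurentCone

/-! ### Extension of the coefficient field -/

section BaseChange

variable {n : ℕ} {K K' : Type*} [Field K] [Field K'] (φ : K →+* K')

theorem mul_comp (ξ η : MvLaurentSeries n K) : mul (φ ∘ ξ) (φ ∘ η) = φ ∘ mul ξ η := by
  ext c
  have h := AddMonoidHom.map_finsum_of_injective φ.toAddMonoidHom φ.injective
    fun a => ξ a * η (c - a)
  refine Eq.trans ?_ h.symm
  exact finsum_congr fun a => (map_mul φ _ _).symm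

theorem pow_comp (ξ : MvLaurentSeries n K) (k : ℕ) : pow (φ ∘ ξ) k = φ ∘ pow ξ k := by
  induction k with
  | zero =>
    ext c
    simp only [pow, Function.comp_apply, Pi.single_apply]
    split_ifs <;> simp
  | succ k ih => rw [pow, ih, mul_comp]; rfl

theorem ofPowerSeries_map (f : MvPowerSeries (Fin n) K) :
    ofPowerSeries (MvPowerSeries.map φ f) = φ ∘ ofPowerSeries f := by
  refine ofPowerSeries_ext (fun m => ?_) fun a ha => ?_
  · rw [Function.comp_apply, ofPowerSeries_natPoint, MvPowerSeries.coeff_map]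
  · rw [Function.comp_apply, ofPowerSeries, if_neg ha, map_zero]

theorem mvPowerSeries_map_injective :
    Function.Injective (MvPowerSeries.map (σ := Fin n) φ) := fun f g h =>
  MvPowerSeries.ext fun m => φ.injective (by
    rw [← MvPowerSeries.coeff_map, h, MvPowerSeries.coeff_map])

theorem IsAlgebraicOverPowerSeries.comp {ξ : MvLaurentSeries n K}
    (h : IsAlgebraicOverPowerSeries ξ) : IsAlgebraicOverPowerSeries (φ ∘ ξ) := by
  obtain ⟨P, hP0, hP⟩ := h
  have hinj := mvPowerSeries_map_injective (n := n) φ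
  refine ⟨P.map (MvPowerSeries.map φ), (Polynomial.map_ne_zero_iff hinj).2 hP0, ?_⟩
  ext c
  have h1 := congrArg φ (congrFun hP c)
  rw [evalAt, Finset.sum_apply, map_sum, Pi.zero_apply, map_zero] at h1
  rw [evalAt, Finset.sum_apply, Pi.zero_apply, ← h1, Polynomial.support_map_of_injective P hinj]
  refine Finset.sum_congr rfl fun k _ => ?_
  rw [Polynomial.coeff_map, ofPowerSeries_map, pow_comp, mul_comp, Function.comp_apply]

end BaseChange

/-- The generic linear form on the lattice, with indeterminate coefficients. -/
noncomputable def genericForm (n : ℕ) (K : Type*) [Field K] :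
    (Fin n → ℤ) →+ FractionRing (MvPolynomial (Fin n) K) where
  toFun a := algebraMap (MvPolynomial (Fin n) K) _ (∑ i, a i • MvPolynomial.X i)
  map_zero' := by simp
  map_add' a b := by simp [add_smul, Finset.sum_add_distrib]

theorem genericForm_injective (n : ℕ) (K : Type*) [Field K] [CharZero K] :
    Function.Injective (genericForm n K) := by
  classical
  rw [injective_iff_map_eq_zero]
  intro a ha
  have h1 : (∑ i, a i • MvPolynomial.X i : MvPolynomial (Fin n) K) = 0 :=
    IsFractionRing.injective _ (FractionRing (MvPolynomial (Fin n) K))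
      (ha.trans (map_zero _).symm)
  ext i
  have h2 := congrArg (MvPolynomial.coeff (Finsupp.single i 1)) h1
  rw [MvPolynomial.coeff_sum, MvPolynomial.coeff_zero] at h2
  simp only [zsmul_eq_mul] at h2
  have h3 : ∀ j, MvPolynomial.coeff (Finsupp.single i 1)
      ((a j : MvPolynomial (Fin n) K) * MvPolynomial.X j) = if j = i then (a j : K) else 0 := by
    intro j
    rw [← map_intCast (MvPolynomial.C (σ := Fin n) (R := K)), MvPolynomial.coeff_C_mul,
      MvPolynomial.coeff_X]
    simp [Finsupp.single_left_inj]
  simp only [h3, Finset.sum_ite_eq', Finset.mem_univ, if_true] at h2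
  exact_mod_cast h2

/-- An injective additive map from the lattice to `K` need not exist (`K = ℚ`, `n = 2`). In
characteristic zero the coefficients are therefore extended to a rational function field, which
keeps both the support and algebraicity. -/
theorem hasExchange_of_isAlgebraic {n : ℕ} {w : (Fin n → ℤ) →+ ℝ} {K : Type*} [Field K]
    (hw : Function.Injective w) (hpos : ∀ i, 0 < w (Pi.single i 1)) {ξ : MvLaurentSeries n K}
    (hξ : DiscreteFor w ξ) (halg : IsAlgebraicOverPowerSeries ξ) :
    HasExchange {a | ξ a ≠ 0} := by
  obtain ⟨p, hp⟩ := CharP.exists K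
  rcases CharP.char_is_prime_or_zero K p with hp' | rfl
  · have : Fact p.Prime := ⟨hp'⟩
    exact hasExchange_of_charP p hw hpos hξ halg
  · have : CharZero K := CharP.charP_to_charZero K
    let K' := FractionRing (MvPolynomial (Fin n) K)
    let φ : K →+* K' := (algebraMap (MvPolynomial (Fin n) K) K').comp MvPolynomial.C
    have : CharZero K' := charZero_of_injective_ringHom φ.injective
    have hne : ∀ a, (φ ∘ ξ) a ≠ 0 ↔ ξ a ≠ 0 := fun a => map_ne_zero φ
    have hξ' : DiscreteFor w (φ ∘ ξ) := by
      intro M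
      simpa only [hne] using hξ M
    have h := hasExchange_of_charZero hw hpos (genericForm n K) (genericForm_injective n K) hξ'
      (halg.comp φ)
    simpa only [hne] using h

/-! ### The exchange system attached to an ultrafilter -/

open Filter

/-- The exchange property gives an exchange system, with least elements chosen by `U`. -/
theorem HasExchange.exists_exchangeSystem {n : ℕ} {S : Set (Fin n → ℤ)} (h : HasExchange S)
    (U : Ultrafilter ((Fin n → ℚ) →ₗ[ℚ] ℝ))
    (hdisc : ∀ᶠ w : (Fin n → ℚ) →ₗ[ℚ] ℝ in U,
      Function.Injective w ∧ ∀ M : ℝ, {v ∈ toRat '' S | w v ≤ M}.Finite)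
    (hpos : ∀ᶠ w : (Fin n → ℚ) →ₗ[ℚ] ℝ in U, ∀ i, 0 ≤ w (Pi.single i 1)) :
    Nonempty (ExchangeSystem U (toRat '' S)) := by
  classical
  obtain ⟨p, I, A, hp, hI, hA, hex⟩ := h
  let G₀ : Finset (Fin n → ℚ) := Finset.univ.image fun i => Pi.single i 1
  let ρ₀ : PointedCone ℚ (Fin n → ℚ) := PointedCone.hull ℚ (G₀ : Set (Fin n → ℚ))
  have hρ₀ : EventuallyNonneg (U : Filter _) ρ₀ := .hull G₀ fun g hg => by
    obtain ⟨i, -, rfl⟩ := Finset.mem_image.1 hg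
    exact hpos.mono fun w hw => hw i
  have hAρ₀ : ∀ i ∈ I, ∀ a ∈ A i, toRat a ∈ ρ₀ := by
    intro i hi a ha
    have h1 : toRat a = ∑ k, (a k : ℚ) • Pi.single k 1 := by
      conv_lhs => rw [← Finset.univ_sum_single (toRat a)]
      refine Finset.sum_congr rfl fun k _ => ?_
      rw [← Pi.single_smul]; simp [toRat]
    rw [h1]
    refine Submodule.sum_mem _ fun k _ => PointedCone.smul_mem _
      (by exact_mod_cast (hA i hi).2 a ha k) (Submodule.subset_span ?_)
    exact Finset.mem_coe.2 (Finset.mem_image_of_mem _ (Finset.mem_univ k))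
  have hwqo : ∀ i ∈ I, ConeWQO ρ₀ (toRat '' A i) := by
    intro i hi
    refine coneWQO_of_subset_translate ⟨G₀, rfl⟩ ?_ 0 ?_
    · rintro _ ⟨a, -, rfl⟩; exact ⟨a, rfl⟩
    · rintro _ ⟨a, ha, rfl⟩
      rw [sub_zero]; exact hAρ₀ i hi a ha
  -- Each `A i` lies above a finite basis `B i`, in which `U` singles out a least element `u i`.
  -- Adding the differences `b - u i` to the cone puts `A i` inside `u i + ρ`.
  choose! B hB hB' using fun i hi => (hwqo i hi).exists_basis
  have hBne : ∀ i ∈ I, (B i).Nonempty := by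
    intro i hi
    obtain ⟨a, ha⟩ := (hA i hi).1
    obtain ⟨b, hb, -⟩ := hB' i hi _ ⟨a, ha, rfl⟩
    exact ⟨b, hb⟩
  have hu : ∀ i ∈ I, ∃ u ∈ B i, ∀ᶠ w : (Fin n → ℚ) →ₗ[ℚ] ℝ in U, ∀ b ∈ B i, w u ≤ w b :=
    fun i hi => (Ultrafilter.eventually_exists_mem_iff (B i).finite_toSet).1
      (Eventually.of_forall fun w => (B i).exists_min_image w (hBne i hi))
  choose! u hu hu' using hu
  let G : Finset (Fin n → ℚ) := I.biUnion fun i => (B i).image fun b => b - u i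
  let ρ : PointedCone ℚ (Fin n → ℚ) := ρ₀ ⊔ PointedCone.hull ℚ (G : Set (Fin n → ℚ))
  have hG : EventuallyNonneg (U : Filter _) (PointedCone.hull ℚ (G : Set (Fin n → ℚ))) :=
    .hull G fun g hg => by
      obtain ⟨i, hi, hg⟩ := Finset.mem_biUnion.1 hg
      obtain ⟨b, hb, rfl⟩ := Finset.mem_image.1 hg
      exact (hu' i hi).mono fun w hw => by
        have := hw b hb
        rw [map_sub]; linarith
  have huA : ∀ i ∈ I, ∃ a ∈ A i, toRat a = u i := fun i hi => hB i hi _ (hu i hi)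
  choose! a₀ ha₀ ha₀' using huA
  have hX : ∀ i ∈ I, ∃ W : Finset (Fin n → ℤ), ∀ v ∈ S, v ∉ W →
      ∃ j ∈ I, ∃ a' ∈ A j, ∃ v' ∈ S, (j, a', v') ≠ (i, a₀ i, v) ∧
        p ^ i • v + a₀ i = p ^ j • v' + a' := fun i hi => hex i hi _ (ha₀ i hi)
  choose! X hX using hX
  have hsmul : ∀ (k : ℕ) (v : Fin n → ℤ), toRat (p ^ k • v) = (p : ℚ) ^ k • toRat v := by
    intro k v
    ext x
    simp [toRat]
  have htoRat : Function.Injective (toRat (n := n)) := fun a b h =>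
    funext fun i => Int.cast_injective (congrFun h i)
  exact ⟨
    { p := p
      I := I
      A := fun i => toRat '' A i
      u := u
      -- The critical points, together with the exceptions of the exchanges at the elements `u i`.
      W := (I ×ˢ I).image (fun ij => ((p : ℚ) ^ ij.2 - (p : ℚ) ^ ij.1)⁻¹ • (u ij.1 - u ij.2)) ∪
        I.biUnion fun i => (X i).image toRat
      ρ := ρ
      one_lt := by exact_mod_cast hp
      nonempty := hI
      fg := Submodule.FG.sup ⟨G₀, rfl⟩ ⟨G, rfl⟩
      eventuallyNonneg := hρ₀.sup hG
      wqo := fun i hi => (hwqo i hi).mono le_sup_left le_rfl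
      sub_mem := by
        rintro i hi _ ⟨a, ha, rfl⟩
        obtain ⟨b, hb, hab⟩ := hB' i hi _ ⟨a, ha, rfl⟩
        rw [← sub_add_sub_cancel _ b]
        refine ρ.add_mem ((le_sup_left : ρ₀ ≤ ρ) hab)
          ((le_sup_right : PointedCone.hull ℚ (G : Set (Fin n → ℚ)) ≤ ρ)
            (Submodule.subset_span ?_))
        exact Finset.mem_coe.2 (Finset.mem_biUnion.2 ⟨i, hi, Finset.mem_image_of_mem _ hb⟩)
      integral := by
        rintro _ ⟨v, -, rfl⟩; exact ⟨v, rfl⟩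
      discrete := hdisc
      crit_mem := fun i hi j hj _ => Finset.mem_union_left _
        (Finset.mem_image.2 ⟨(i, j), Finset.mem_product.2 ⟨hi, hj⟩, rfl⟩)
      exchange := by
        rintro i hi _ ⟨v, hv, rfl⟩ hvW
        have hvX : v ∉ X i := fun h => hvW (Finset.mem_union_right _
          (Finset.mem_biUnion.2 ⟨i, hi, Finset.mem_image_of_mem _ h⟩))
        obtain ⟨j, hj, a', ha', v', hv', hne, heq⟩ := hX i hi v hv hvX
        refine ⟨j, hj, _, ⟨a', ha', rfl⟩, _, ⟨v', hv', rfl⟩, fun h => hne ?_, ?_⟩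
        · rw [Prod.mk.injEq, Prod.mk.injEq, ← ha₀' i hi] at h
          rw [h.1, htoRat h.2.1, htoRat h.2.2]
        · rw [← ha₀' i hi, ← hsmul, ← hsmul, ← toRat_add, ← toRat_add, heq] }⟩

end LaurentCone

namespace LaurentCone

open Filter Topology

/-! ### Weights given by real vectors -/

section Weights

variable {n : ℕ}

/-- A rational vector seen as a real vector. -/
def ratToReal (q : Fin n → ℚ) : Fin n → ℝ := fun i => (q i : ℝ)

theorem ratToReal_add (p q : Fin n → ℚ) : ratToReal (p + q) = ratToReal p + ratToReal q := by
  ext i; simp [ratToReal]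

theorem ratToReal_smul (r : ℚ) (q : Fin n → ℚ) : ratToReal (r • q) = (r : ℝ) • ratToReal q := by
  ext i; simp [ratToReal]

theorem ratToReal_toRat (a : Fin n → ℤ) : ratToReal (toRat a) = toReal a := by
  ext i; simp [ratToReal, toRat, toReal]

theorem ratToReal_dotProduct (p q : Fin n → ℚ) :
    ratToReal p ⬝ᵥ ratToReal q = ((p ⬝ᵥ q : ℚ) : ℝ) := by
  simp [dotProduct, ratToReal]

/-- The pairing with a real vector, as a linear form on rational vectors. -/
def weight (ω : Fin n → ℝ) : (Fin n → ℚ) →ₗ[ℚ] ℝ where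
  toFun q := ratToReal q ⬝ᵥ ω
  map_add' p q := by rw [ratToReal_add, add_dotProduct]
  map_smul' r q := by
    rw [ratToReal_smul, smul_dotProduct, RingHom.id_apply, Rat.smul_def, smul_eq_mul]

theorem weight_apply (ω : Fin n → ℝ) (q : Fin n → ℚ) : weight ω q = ratToReal q ⬝ᵥ ω := rfl

theorem weight_toRat (ω : Fin n → ℝ) (a : Fin n → ℤ) : weight ω (toRat a) = toReal a ⬝ᵥ ω := by
  rw [weight_apply, ratToReal_toRat]

theorem toReal_add (a b : Fin n → ℤ) : toReal (a + b) = toReal a + toReal b := by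
  ext i; simp [toReal]

/-- A generic weight exists in every nonempty open set. -/
theorem exists_injective_weight {O : Set (Fin n → ℝ)} (hO : IsOpen O) (hne : O.Nonempty) :
    ∃ ω ∈ O, Function.Injective (weight ω) := by
  by_contra! hcon
  -- A weight that is not injective lies on one of countably many hyperplanes, and these form a null
  -- set.
  let H : (Fin n → ℚ) → Submodule ℝ (Fin n → ℝ) := fun q =>
    { carrier := {ω | ratToReal q ⬝ᵥ ω = 0}
      zero_mem' := dotProduct_zero _
      add_mem' := fun {a b} ha hb => by
        rw [Set.mem_ofPred_eq] at *
        rw [dotProduct_add, ha, hb, add_zero]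
      smul_mem' := fun r a ha => by
        rw [Set.mem_ofPred_eq] at *
        rw [dotProduct_smul, ha, smul_zero] }
  have hH : ∀ q ≠ 0, MeasureTheory.volume (H q : Set (Fin n → ℝ)) = 0 := by
    intro q hq
    refine MeasureTheory.Measure.addHaar_submodule _ _ fun htop => hq ?_
    have h1 : ratToReal q ∈ H q := htop ▸ Submodule.mem_top
    have h2 : ratToReal q ⬝ᵥ ratToReal q = 0 := h1
    rw [dotProduct_self_eq_zero] at h2
    ext i
    exact Rat.cast_injective ((congrFun h2 i).trans Rat.cast_zero.symm)
  have hsub : O ⊆ ⋃ q : {q : Fin n → ℚ // q ≠ 0}, (H q : Set (Fin n → ℝ)) := by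
    intro ω hω
    have h1 := hcon ω hω
    rw [injective_iff_map_eq_zero] at h1
    push Not at h1
    obtain ⟨q, hq, hq0⟩ := h1
    exact Set.mem_iUnion.2 ⟨⟨q, hq0⟩, hq⟩
  have h0 : MeasureTheory.volume O = 0 := MeasureTheory.measure_mono_null hsub
    (MeasureTheory.measure_iUnion_null fun q => hH q q.2)
  exact (hO.measure_pos MeasureTheory.volume hne).ne' h0

/-- The vectors of the orthant that are nonnegative on a cone. -/
def dualInOrthant (ρ : PointedCone ℚ (Fin n → ℚ)) : Set (Fin n → ℝ) :=
  {ω | ω ∈ orthant n ∧ ∀ g ∈ ρ, 0 ≤ weight ω g}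

/-- The generic weights with respect to which `S` is discrete. -/
def genericWeights (S : Set (Fin n → ℤ)) : Set (Fin n → ℝ) :=
  {ω | ω ∈ orthant n ∧ Function.Injective (weight ω) ∧
    ∀ M : ℝ, {v ∈ toRat '' S | weight ω v ≤ M}.Finite}

/-- If no finite family sufficed, some ultrafilter would contain `genericWeights S` and the
complement of every admissible dual cone. But the cone given by `ExchangeSystem.conical` has its
dual in that ultrafilter. -/
theorem exists_finite_cover {S : Set (Fin n → ℤ)} (hS : HasExchange S) :
    ∃ 𝒟 : Set (Set (Fin n → ℝ)), 𝒟.Finite ∧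
      (∀ C ∈ 𝒟, ∃ ρ : PointedCone ℚ (Fin n → ℚ), ρ.FG ∧ ConeWQO ρ (toRat '' S) ∧
        C = dualInOrthant ρ) ∧ genericWeights S ⊆ ⋃₀ 𝒟 := by
  by_contra! hcon
  let good : Set (Set (Fin n → ℝ)) := {C | ∃ ρ : PointedCone ℚ (Fin n → ℚ), ρ.FG ∧
    ConeWQO ρ (toRat '' S) ∧ C = dualInOrthant ρ}
  obtain ⟨U, hU⟩ := Ultrafilter.exists_ultrafilter_of_finite_inter_nonempty
    (insert (genericWeights S) (compl '' good)) fun T hT => by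
      obtain ⟨ω, hω, hω'⟩ := Set.not_subset.1 (hcon ((compl '' (T : Set (Set (Fin n → ℝ)))) ∩ good)
        ((T.finite_toSet.image _).inter_of_left _) fun C hC => hC.2)
      refine ⟨ω, fun t ht => ?_⟩
      rcases hT ht with rfl | ⟨C, hC, rfl⟩
      · exact hω
      · exact fun h => hω' ⟨C, ⟨⟨Cᶜ, ht, compl_compl C⟩, hC⟩, h⟩
  have hgen : ∀ᶠ ω in (U : Filter _), ω ∈ genericWeights S := hU (Set.mem_insert _ _)
  obtain ⟨X⟩ := hS.exists_exchangeSystem (U.map weight)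
    (by
      rw [Ultrafilter.coe_map, eventually_map]
      exact hgen.mono fun ω h => h.2)
    (by
      rw [Ultrafilter.coe_map, eventually_map]
      refine hgen.mono fun ω h i => ?_
      have h1 : weight ω (Pi.single i 1) = ω i := by
        have : ratToReal (Pi.single i 1 : Fin n → ℚ) = Pi.single i 1 := by
          ext j
          simp only [ratToReal, Pi.single_apply]
          split_ifs <;> simp
        rw [weight_apply, this, single_one_dotProduct]
      rw [h1]; exact h.1 i)
  obtain ⟨ρ, hfg, hpos, hwqo⟩ := X.conical
  rw [EventuallyNonneg, Ultrafilter.coe_map, eventually_map] at hpos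
  have h2 : ∀ᶠ ω in (U : Filter _), ω ∈ (dualInOrthant ρ)ᶜ :=
    hU (Set.mem_insert_of_mem _ ⟨_, ⟨ρ, hfg, hwqo, rfl⟩, rfl⟩)
  obtain ⟨ω, h, h', h''⟩ := (hgen.and (hpos.and h2)).exists
  exact h'' ⟨h.1, h'⟩

end Weights

/-! ### Rational cones -/

section RationalCones

variable {n : ℕ}

theorem coneGeneratedBy_eq_hull (s : Finset (Fin n → ℝ)) :
    coneGeneratedBy s = (PointedCone.hull ℝ (s : Set (Fin n → ℝ)) : Set (Fin n → ℝ)) := by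
  ext v
  constructor
  · rintro ⟨c, hc, rfl⟩
    exact Submodule.sum_mem _ fun u hu => PointedCone.smul_mem _ (hc u hu)
      (Submodule.subset_span hu)
  · intro hv
    obtain ⟨l, -, hl⟩ := Submodule.mem_span_finset.1 hv
    exact ⟨fun u => l u, fun u _ => (l u).2, hl.symm⟩

/-- The real cone generated by rational vectors. -/
def ratHull (G : Set (Fin n → ℚ)) : PointedCone ℝ (Fin n → ℝ) :=
  PointedCone.hull ℝ (ratToReal '' G)

theorem ratToReal_mem_ratHull {G : Set (Fin n → ℚ)} {q : Fin n → ℚ} (hq : q ∈ G) :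
    ratToReal q ∈ ratHull G := Submodule.subset_span ⟨q, hq, rfl⟩

theorem ratHull_le_iff {G : Set (Fin n → ℚ)} {C : PointedCone ℝ (Fin n → ℝ)} :
    ratHull G ≤ C ↔ ∀ q ∈ G, ratToReal q ∈ C := by
  rw [ratHull, PointedCone.hull, Submodule.span_le, Set.image_subset_iff]
  rfl

theorem ratHull_mono {G G' : Set (Fin n → ℚ)} (h : G ⊆ G') : ratHull G ≤ ratHull G' :=
  ratHull_le_iff.2 fun _ hq => ratToReal_mem_ratHull (h hq)

theorem exists_of_mem_ratHull {G : Finset (Fin n → ℚ)} {v : Fin n → ℝ}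
    (hv : v ∈ ratHull (G : Set (Fin n → ℚ))) :
    ∃ c : (Fin n → ℚ) → ℝ, (∀ q, 0 ≤ c q) ∧ v = ∑ q ∈ G, c q • ratToReal q := by
  classical
  have hinj : Function.Injective (ratToReal (n := n)) := fun a b h =>
    funext fun i => Rat.cast_injective (congrFun h i)
  have : v ∈ PointedCone.hull ℝ ((G.image ratToReal : Finset (Fin n → ℝ)) : Set (Fin n → ℝ)) := by
    rw [Finset.coe_image]; exact hv
  obtain ⟨l, -, hl⟩ := Submodule.mem_span_finset.1 this
  refine ⟨fun q => l (ratToReal q), fun q => (l _).2, ?_⟩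
  rw [← hl, Finset.sum_image hinj.injOn]
  rfl

theorem isRationalCone_ratHull (G : Finset (Fin n → ℚ)) :
    IsRationalCone (ratHull (G : Set (Fin n → ℚ)) : Set (Fin n → ℝ)) := by
  classical
  obtain ⟨d, hd, hdG⟩ := exists_common_denominator G
  have hd' : (0 : ℝ) < d := by exact_mod_cast hd
  have hsm : ∀ g, ratToReal ((d : ℚ) • g) = (d : ℝ) • ratToReal (n := n) g := fun g => by
    rw [ratToReal_smul]; simp
  refine ⟨G.image fun g => ratToReal ((d : ℚ) • g), fun u hu => ?_, ?_⟩
  · obtain ⟨g, hg, rfl⟩ := Finset.mem_image.1 hu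
    obtain ⟨z, hz⟩ := hdG g hg
    exact ⟨z, by rw [hz, ratToReal_toRat]⟩
  · rw [coneGeneratedBy_eq_hull]
    congr 1
    apply le_antisymm
    · refine ratHull_le_iff.2 fun g hg => ?_
      have h1 : ratToReal g = (d : ℝ)⁻¹ • ratToReal ((d : ℚ) • g) := by
        rw [hsm, inv_smul_smul₀ hd'.ne']
      rw [h1]
      exact PointedCone.smul_mem _ (inv_nonneg.2 hd'.le)
        (Submodule.subset_span (Finset.mem_coe.2 (Finset.mem_image_of_mem _ hg)))
    · refine Submodule.span_le.2 fun u hu => ?_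
      obtain ⟨g, hg, rfl⟩ := Finset.mem_image.1 (Finset.mem_coe.1 hu)
      rw [hsm]
      exact PointedCone.smul_mem _ hd'.le (ratToReal_mem_ratHull hg)

/-- The intersection of a rational cone with a rational half-space is a rational cone. -/
theorem exists_ratHull_inter_halfSpace (G : Finset (Fin n → ℚ)) (g : Fin n → ℚ) :
    ∃ G' : Finset (Fin n → ℚ), (ratHull (G' : Set (Fin n → ℚ)) : Set (Fin n → ℝ)) =
      {v | v ∈ ratHull (G : Set (Fin n → ℚ)) ∧ 0 ≤ ratToReal g ⬝ᵥ v} := by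
  classical
  let P := G.filter fun q => 0 ≤ g ⬝ᵥ q
  let N := G.filter fun q => ¬ 0 ≤ g ⬝ᵥ q
  -- The combination of `u` and `v` that lies on the hyperplane orthogonal to `g`.
  let comb : (Fin n → ℚ) × (Fin n → ℚ) → (Fin n → ℚ) := fun uv =>
    (g ⬝ᵥ uv.1) • uv.2 + (-(g ⬝ᵥ uv.2)) • uv.1
  let G' := P ∪ (P ×ˢ N).image comb
  have hP : ∀ u ∈ P, u ∈ G ∧ 0 ≤ g ⬝ᵥ u := fun u hu => Finset.mem_filter.1 hu
  have hN : ∀ u ∈ N, u ∈ G ∧ g ⬝ᵥ u < 0 := fun u hu =>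
    ⟨(Finset.mem_filter.1 hu).1, not_le.1 (Finset.mem_filter.1 hu).2⟩
  have hcomb : ∀ u v, ratToReal (comb (u, v)) =
      (ratToReal g ⬝ᵥ ratToReal u) • ratToReal v + (-(ratToReal g ⬝ᵥ ratToReal v)) • ratToReal u := by
    intro u v
    simp only [comb, ratToReal_add, ratToReal_smul, ratToReal_dotProduct]
    push_cast
    rfl
  refine ⟨G', Set.Subset.antisymm ?_ ?_⟩
  · let H : PointedCone ℝ (Fin n → ℝ) :=
      { carrier := {v | v ∈ ratHull (G : Set (Fin n → ℚ)) ∧ 0 ≤ ratToReal g ⬝ᵥ v}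
        zero_mem' := ⟨Submodule.zero_mem _, by rw [dotProduct_zero]⟩
        add_mem' := fun {a b} ha hb => ⟨Submodule.add_mem _ ha.1 hb.1, by
          rw [dotProduct_add]; exact add_nonneg ha.2 hb.2⟩
        smul_mem' := fun r a ha => ⟨Submodule.smul_mem _ r ha.1, by
          have : ratToReal g ⬝ᵥ (r • a) = (r : ℝ) * (ratToReal g ⬝ᵥ a) := dotProduct_smul (r : ℝ) _ _
          rw [this]; exact mul_nonneg r.2 ha.2⟩ }
    have hle : ratHull (G' : Set (Fin n → ℚ)) ≤ H := by
      refine ratHull_le_iff.2 fun q hq => ?_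
      rcases Finset.mem_union.1 (Finset.mem_coe.1 hq) with hq | hq
      · refine ⟨ratToReal_mem_ratHull (hP q hq).1, ?_⟩
        rw [ratToReal_dotProduct]
        exact_mod_cast (hP q hq).2
      · obtain ⟨⟨u, v⟩, huv, rfl⟩ := Finset.mem_image.1 hq
        obtain ⟨hu, hv⟩ := Finset.mem_product.1 huv
        have hu0 : 0 ≤ ratToReal g ⬝ᵥ ratToReal u := by
          rw [ratToReal_dotProduct]; exact_mod_cast (hP u hu).2
        have hv0 : ratToReal g ⬝ᵥ ratToReal v ≤ 0 := by
          rw [ratToReal_dotProduct]; exact_mod_cast (hN v hv).2.le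
        refine ⟨?_, ?_⟩
        · rw [hcomb]
          exact Submodule.add_mem _
            (PointedCone.smul_mem _ hu0 (ratToReal_mem_ratHull (hN v hv).1))
            (PointedCone.smul_mem _ (neg_nonneg.2 hv0) (ratToReal_mem_ratHull (hP u hu).1))
        · rw [hcomb, dotProduct_add, dotProduct_smul, dotProduct_smul]
          simp only [smul_eq_mul]
          exact le_of_eq (by ring)
    exact hle
  · rintro v ⟨hv, hgv⟩
    obtain ⟨c, hc, rfl⟩ := exists_of_mem_ratHull hv
    let f : (Fin n → ℚ) → ℝ := fun q => ratToReal g ⬝ᵥ ratToReal q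
    have hfP : ∀ u ∈ P, 0 ≤ f u := fun u hu => by
      simp only [f, ratToReal_dotProduct]; exact_mod_cast (hP u hu).2
    have hfN : ∀ u ∈ N, f u < 0 := fun u hu => by
      simp only [f, ratToReal_dotProduct]; exact_mod_cast (hN u hu).2
    have hsplit : ∑ q ∈ G, c q • ratToReal q =
        ∑ u ∈ P, c u • ratToReal u + ∑ u ∈ N, c u • ratToReal u :=
      (Finset.sum_filter_add_sum_filter_not G _ _).symm
    let a := ∑ u ∈ P, c u * f u
    let b := ∑ u ∈ N, c u * -f u
    have hb0 : ∀ u ∈ N, 0 ≤ c u * -f u := fun u hu =>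
      mul_nonneg (hc u) (neg_nonneg.2 (hfN u hu).le)
    have hb : 0 ≤ b := Finset.sum_nonneg hb0
    have hab : b ≤ a := by
      rw [hsplit, dotProduct_add, dotProduct_sum, dotProduct_sum] at hgv
      simp only [dotProduct_smul, smul_eq_mul] at hgv
      simp only [a, b, mul_neg, Finset.sum_neg_distrib]
      linarith
    have hPG : ∀ u ∈ P, ratToReal u ∈ ratHull (G' : Set (Fin n → ℚ)) := fun u hu =>
      ratToReal_mem_ratHull (Finset.mem_coe.2 (Finset.mem_union_left _ hu))
    rcases hb.eq_or_lt with hb' | hb'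
    · have hzero : ∀ u ∈ N, c u = 0 := by
        intro u hu
        have := (Finset.sum_eq_zero_iff_of_nonneg hb0).1 hb'.symm u hu
        exact (mul_eq_zero.1 this).resolve_right (neg_ne_zero.2 (hfN u hu).ne)
      rw [hsplit, Finset.sum_eq_zero (s := N) fun u hu => by rw [hzero u hu, zero_smul], add_zero]
      exact Submodule.sum_mem _ fun u hu => PointedCone.smul_mem _ (hc u) (hPG u hu)
    · have ha : 0 < a := hb'.trans_le hab
      -- Each `v ∈ N` is balanced against all `u ∈ P`, in proportion to `c u * f u / a`. Altogether
      -- this uses the share `b / a ≤ 1` of every `c u`.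
      have key : ∑ q ∈ G, c q • ratToReal q = ∑ u ∈ P, (c u * (1 - b / a)) • ratToReal u +
          ∑ v ∈ N, ∑ u ∈ P, (c u * c v / a) • ratToReal (comb (u, v)) := by
        have e1 : ∀ v ∈ N, ∑ u ∈ P, (c u * c v / a) • ratToReal (comb (u, v)) =
            c v • ratToReal v + ∑ u ∈ P, (c u * (c v * -f v) / a) • ratToReal u := by
          intro v _
          have e2 : ∀ u ∈ P, (c u * c v / a) • ratToReal (comb (u, v)) =
              (c u * f u * (c v / a)) • ratToReal v +
                (c u * (c v * -f v) / a) • ratToReal u := by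
            intro u _
            rw [hcomb, smul_add, smul_smul, smul_smul]
            congr 2 <;> simp only [f] <;> ring
          rw [Finset.sum_congr rfl e2, Finset.sum_add_distrib, ← Finset.sum_smul,
            ← Finset.sum_mul]
          congr 2
          exact mul_div_cancel₀ _ ha.ne'
        rw [Finset.sum_congr rfl e1, Finset.sum_add_distrib, hsplit, Finset.sum_comm]
        have e3 : ∀ u ∈ P, ∑ v ∈ N, (c u * (c v * -f v) / a) • ratToReal u =
            (c u * (b / a)) • ratToReal u := by
          intro u _
          rw [← Finset.sum_smul]
          congr 1
          simp only [b, mul_div_assoc, Finset.mul_sum, Finset.sum_div]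
        rw [Finset.sum_congr rfl e3]
        simp only [mul_sub, mul_one, sub_smul, Finset.sum_sub_distrib]
        abel
      rw [key]
      have h1 : 0 ≤ 1 - b / a := sub_nonneg.2 ((div_le_one ha).2 hab)
      refine Submodule.add_mem _
        (Submodule.sum_mem _ fun u hu => PointedCone.smul_mem _ (mul_nonneg (hc u) h1) (hPG u hu))
        (Submodule.sum_mem _ fun v hv => Submodule.sum_mem _ fun u hu => PointedCone.smul_mem _
          (div_nonneg (mul_nonneg (hc u) (hc v)) ha.le) (ratToReal_mem_ratHull ?_))
      exact Finset.mem_coe.2 (Finset.mem_union_right _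
        (Finset.mem_image_of_mem _ (Finset.mem_product.2 ⟨hu, hv⟩)))

theorem exists_ratHull_eq_orthant (n : ℕ) : ∃ G : Finset (Fin n → ℚ),
    (ratHull (G : Set (Fin n → ℚ)) : Set (Fin n → ℝ)) = orthant n := by
  classical
  have hs : ∀ i, ratToReal (Pi.single i 1 : Fin n → ℚ) = Pi.single i 1 := fun i => by
    ext j
    simp only [ratToReal, Pi.single_apply]
    split_ifs <;> simp
  refine ⟨Finset.univ.image fun i => Pi.single i 1, Set.Subset.antisymm ?_ fun v hv => ?_⟩
  · intro v hv
    obtain ⟨c, hc, rfl⟩ := exists_of_mem_ratHull hv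
    intro j
    rw [Finset.sum_apply]
    refine Finset.sum_nonneg fun q hq => ?_
    obtain ⟨i, -, rfl⟩ := Finset.mem_image.1 hq
    rw [hs, Pi.smul_apply, Pi.single_apply, smul_eq_mul]
    exact mul_nonneg (hc _) (by split_ifs <;> norm_num)
  · have h1 : v = ∑ i, v i • (Pi.single i 1 : Fin n → ℝ) := by
      conv_lhs => rw [← Finset.univ_sum_single v]
      refine Finset.sum_congr rfl fun i _ => ?_
      rw [← Pi.single_smul, smul_eq_mul, mul_one]
    rw [h1]
    refine Submodule.sum_mem _ fun i _ => PointedCone.smul_mem _ (hv i) ?_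
    rw [← hs]
    exact ratToReal_mem_ratHull
      (Finset.mem_coe.2 (Finset.mem_image_of_mem _ (Finset.mem_univ i)))

theorem exists_ratHull_eq_dualInOrthant {ρ : PointedCone ℚ (Fin n → ℚ)} (hρ : ρ.FG) :
    ∃ G : Finset (Fin n → ℚ),
      (ratHull (G : Set (Fin n → ℚ)) : Set (Fin n → ℝ)) = dualInOrthant ρ := by
  classical
  obtain ⟨s, rfl⟩ := hρ
  have key : ∃ G : Finset (Fin n → ℚ), (ratHull (G : Set (Fin n → ℚ)) : Set (Fin n → ℝ)) =
      {ω | ω ∈ orthant n ∧ ∀ g ∈ s, 0 ≤ weight ω g} := by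
    induction s using Finset.induction_on with
    | empty =>
      obtain ⟨G, hG⟩ := exists_ratHull_eq_orthant n
      exact ⟨G, by rw [hG]; simp⟩
    | insert g s _ ih =>
      obtain ⟨G, hG⟩ := ih
      obtain ⟨G', hG'⟩ := exists_ratHull_inter_halfSpace G g
      refine ⟨G', ?_⟩
      rw [hG']
      ext ω
      have h1 : ω ∈ ratHull (G : Set (Fin n → ℚ)) ↔
          ω ∈ orthant n ∧ ∀ g ∈ s, 0 ≤ weight ω g := by
        rw [← SetLike.mem_coe, hG]; rfl
      simp only [Set.mem_ofPred_eq, h1, Finset.forall_mem_insert, weight_apply]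
      tauto
  obtain ⟨G, hG⟩ := key
  refine ⟨G, hG.trans ?_⟩
  ext ω
  refine and_congr_right fun _ => ⟨fun h g hg => map_nonneg_of_mem_hull h hg, fun h g hg =>
    h g (Submodule.subset_span hg)⟩

end RationalCones

end LaurentCone

namespace LaurentCone

open Filter Topology

/-! ### The cone `τ(ξ)` and its generic weights -/

section Tau

variable {n : ℕ} {K : Type*}

theorem mem_tau_iff [Zero K] {ξ : MvLaurentSeries n K} {ω : Fin n → ℝ} :
    ω ∈ tau ξ ↔ ω ∈ orthant n ∧ ∃ k : ℝ, ∀ a, ξ a ≠ 0 → k < toReal a ⬝ᵥ ω := by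
  refine and_congr_right fun _ => exists_congr fun k => ?_
  rw [Set.eq_empty_iff_forall_notMem]
  constructor
  · intro h a ha
    by_contra hk
    exact h (toReal a) ⟨⟨a, ha, rfl⟩, not_lt.1 hk⟩
  · rintro h _ ⟨⟨a, ha, rfl⟩, hk⟩
    exact absurd (h a ha) (not_lt.2 hk)

/-- The set `τ(ξ)` is a convex cone. -/
def tauCone [Zero K] (ξ : MvLaurentSeries n K) : PointedCone ℝ (Fin n → ℝ) where
  carrier := tau ξ
  zero_mem' := mem_tau_iff.2 ⟨fun _ => le_rfl, -1, fun a _ => by rw [dotProduct_zero]; norm_num⟩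
  add_mem' {v w} hv hw := by
    obtain ⟨hv0, k, hk⟩ := mem_tau_iff.1 hv
    obtain ⟨hw0, l, hl⟩ := mem_tau_iff.1 hw
    exact mem_tau_iff.2 ⟨fun i => add_nonneg (hv0 i) (hw0 i), k + l, fun a ha => by
      rw [dotProduct_add]; exact add_lt_add (hk a ha) (hl a ha)⟩
  smul_mem' r v hv := by
    obtain ⟨hv0, k, hk⟩ := mem_tau_iff.1 hv
    -- The margin `1` keeps the inequality strict when `r = 0`.
    refine mem_tau_iff.2 ⟨fun i => mul_nonneg r.2 (hv0 i), r * k - 1, fun a ha => ?_⟩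
    have h1 : toReal a ⬝ᵥ (r • v) = (r : ℝ) * (toReal a ⬝ᵥ v) := dotProduct_smul (r : ℝ) _ _
    have h2 := mul_le_mul_of_nonneg_left (hk a ha).le r.2
    rw [h1]
    exact lt_of_lt_of_le (sub_one_lt _) h2

theorem isStronglyConvex_tau [Zero K] (ξ : MvLaurentSeries n K) : IsStronglyConvex (tau ξ) := by
  intro W hW
  rw [eq_bot_iff]
  intro v hv
  have h1 := (hW hv).1
  have h2 := (hW (W.neg_mem hv)).1
  rw [Submodule.mem_bot]
  ext i
  have h3 := h2 i
  rw [Pi.neg_apply] at h3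
  exact le_antisymm (neg_nonneg.1 h3) (h1 i)

/-- The support lies in `B + ρ` with `B` finite, so on it `ω` is bounded below by its minimum on
`B`. -/
theorem dualInOrthant_subset_tau [Zero K] {ξ : MvLaurentSeries n K}
    {ρ : PointedCone ℚ (Fin n → ℚ)} (h : ConeWQO ρ (toRat '' {a | ξ a ≠ 0})) :
    dualInOrthant ρ ⊆ tau ξ := by
  intro ω hω
  obtain ⟨B, -, hB⟩ := h.exists_basis
  obtain ⟨k, hk⟩ := ((B.image (weight ω)).finite_toSet).bddBelow
  refine mem_tau_iff.2 ⟨hω.1, k - 1, fun a ha => ?_⟩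
  obtain ⟨b, hb, hab⟩ := hB _ ⟨a, ha, rfl⟩
  have h1 := hω.2 _ hab
  have h2 : k ≤ weight ω b := hk (Finset.mem_coe.2 (Finset.mem_image_of_mem _ hb))
  rw [map_sub, weight_toRat] at h1
  linarith

theorem isClosed_dualInOrthant (ρ : PointedCone ℚ (Fin n → ℚ)) : IsClosed (dualInOrthant ρ) := by
  have h1 : dualInOrthant ρ = (⋂ i, {ω : Fin n → ℝ | 0 ≤ ω i}) ∩
      ⋂ g ∈ ρ, {ω : Fin n → ℝ | 0 ≤ weight ω g} := by
    ext ω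
    simp [dualInOrthant, orthant]
  rw [h1]
  refine (isClosed_iInter fun i => isClosed_le continuous_const (continuous_apply i)).inter
    (isClosed_biInter fun g _ => isClosed_le continuous_const ?_)
  change Continuous fun ω : Fin n → ℝ => ∑ i, ratToReal g i * ω i
  fun_prop

/-! ### Weights positive on a strongly convex cone -/

/-- The weights that are positive on the nonzero elements of `s`. -/
def positiveWeights (s : Finset (Fin n → ℝ)) : Set (Fin n → ℝ) :=
  {η | ∀ g ∈ s, g ≠ 0 → 0 < g ⬝ᵥ η}

theorem isOpen_positiveWeights (s : Finset (Fin n → ℝ)) : IsOpen (positiveWeights s) := by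
  have h1 : positiveWeights s = ⋂ g ∈ s.filter (· ≠ 0), {η : Fin n → ℝ | 0 < g ⬝ᵥ η} := by
    ext η
    simp [positiveWeights]
  rw [h1]
  refine isOpen_biInter_finset fun g _ => isOpen_lt continuous_const ?_
  change Continuous fun η : Fin n → ℝ => ∑ i, g i * η i
  fun_prop

theorem smul_mem_positiveWeights {s : Finset (Fin n → ℝ)} {η : Fin n → ℝ}
    (h : η ∈ positiveWeights s) {r : ℝ} (hr : 0 < r) : r • η ∈ positiveWeights s := by
  intro g hg hg0
  rw [dotProduct_smul]
  exact mul_pos hr (h g hg hg0)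

/-- Strong convexity keeps `0` out of the convex hull of the nonzero generators, and Hahn–Banach
separates the two. -/
theorem positiveWeights_nonempty {s : Finset (Fin n → ℝ)}
    (hs : IsStronglyConvex (coneGeneratedBy s)) : (positiveWeights s).Nonempty := by
  classical
  let t := s.filter (· ≠ 0)
  have h0 : (0 : Fin n → ℝ) ∉ convexHull ℝ (t : Set (Fin n → ℝ)) := by
    intro h
    rw [Finset.mem_convexHull'] at h
    obtain ⟨c, hc, hc1, hc0⟩ := h
    obtain ⟨g, hg, hcg⟩ : ∃ g ∈ t, c g ≠ 0 := by
      by_contra! hcon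
      rw [Finset.sum_eq_zero hcon] at hc1
      exact zero_ne_one hc1
    have hmem : ∀ u ∈ t, c u • u ∈ coneGeneratedBy s := fun u hu =>
      smul_mem_cone (hc u hu) (mem_cone_of_mem (Finset.mem_filter.1 hu).1)
    have hneg : -(c g • g) ∈ coneGeneratedBy s := by
      rw [← Finset.add_sum_erase t (fun u => c u • u) hg] at hc0
      rw [← eq_neg_of_add_eq_zero_right hc0, coneGeneratedBy_eq_hull]
      refine Submodule.sum_mem _ fun u hu => ?_
      have := hmem u (Finset.mem_of_mem_erase hu)
      rwa [coneGeneratedBy_eq_hull] at this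
    rcases smul_eq_zero.1 (eq_zero_of_neg_mem ⟨s, rfl⟩ hs (hmem g hg) hneg) with h | h
    · exact hcg h
    · exact (Finset.mem_filter.1 hg).2 h
  obtain ⟨f, u, hfu, hf⟩ := geometric_hahn_banach_point_closed (convex_convexHull ℝ _)
    (t.finite_toSet.isClosed_convexHull ℝ) h0
  rw [map_zero] at hfu
  refine ⟨fun i => f (Pi.single i 1), fun g hg hg0 => ?_⟩
  have h1 : g ⬝ᵥ (fun i => f (Pi.single i 1)) = f g := by
    conv_rhs => rw [← Finset.univ_sum_single g]
    rw [map_sum]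
    refine Finset.sum_congr rfl fun i _ => ?_
    have : (Pi.single i (g i) : Fin n → ℝ) = g i • Pi.single i 1 := by
      rw [← Pi.single_smul, smul_eq_mul, mul_one]
    rw [this, map_smul, smul_eq_mul]
  rw [h1]
  exact hfu.trans (hf g (subset_convexHull ℝ _ (Finset.mem_coe.2 (Finset.mem_filter.2 ⟨hg, hg0⟩))))

theorem pos_of_mem_positiveWeights {s : Finset (Fin n → ℝ)} (hs : orthant n ⊆ coneGeneratedBy s)
    {η : Fin n → ℝ} (hη : η ∈ positiveWeights s) (i : Fin n) : 0 < η i := by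
  have h1 : (Pi.single i 1 : Fin n → ℝ) ∈ orthant n := fun j => by
    rw [Pi.single_apply]; split_ifs <;> norm_num
  obtain ⟨c, hc, h⟩ := hs h1
  have h2 : η i = ∑ u ∈ s, c u * (u ⬝ᵥ η) := by
    rw [← single_one_dotProduct i η, h, sum_dotProduct]
    simp only [smul_dotProduct, smul_eq_mul]
  have h3 : ∀ u ∈ s, 0 ≤ c u * (u ⬝ᵥ η) := fun u hu => by
    rcases eq_or_ne u 0 with rfl | h0
    · simp
    · exact mul_nonneg (hc u hu) (hη u hu h0).le
  refine lt_of_le_of_ne (h2 ▸ Finset.sum_nonneg h3) fun h0 => ?_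
  rw [← h0, eq_comm, Finset.sum_eq_zero_iff_of_nonneg h3] at h2
  have h4 : (Pi.single i 1 : Fin n → ℝ) = 0 := by
    rw [h]
    refine Finset.sum_eq_zero fun u hu => ?_
    rcases eq_or_ne u 0 with rfl | hu0
    · simp
    · rw [(mul_eq_zero.1 (h2 u hu)).resolve_right (hη u hu hu0).ne', zero_smul]
  have := congrFun h4 i
  simp at this

theorem finite_lattice_points {s : Finset (Fin n → ℝ)} {η : Fin n → ℝ}
    (hη : η ∈ positiveWeights s) (γ : Fin n → ℝ) (M : ℝ) :
    {a : Fin n → ℤ | toReal a ∈ coneTranslate γ (coneGeneratedBy s) ∧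
      toReal a ⬝ᵥ η ≤ M}.Finite := by
  let L := M - γ ⬝ᵥ η
  -- A zero generator contributes `0 / 0 = 0`.
  let B : Fin n → ℝ := fun i => ∑ g ∈ s, |g i| / (g ⬝ᵥ η)
  have hfin : (Set.univ.pi fun i : Fin n =>
      Set.Icc ⌈γ i - L * B i⌉ ⌊γ i + L * B i⌋ : Set (Fin n → ℤ)).Finite :=
    Set.Finite.pi fun i => Set.finite_Icc _ _
  refine hfin.subset fun a ha i _ => ?_
  obtain ⟨⟨c, hc, hca⟩, haM⟩ := ha
  have hg0 : ∀ g ∈ s, 0 ≤ g ⬝ᵥ η := fun g hg => by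
    rcases eq_or_ne g 0 with rfl | h0
    · simp
    · exact (hη g hg h0).le
  have hB : ∀ g ∈ s, |g i| ≤ (g ⬝ᵥ η) * B i := fun g hg => by
    rcases eq_or_ne g 0 with rfl | h0
    · simp
    · have h1 : |g i| / (g ⬝ᵥ η) ≤ B i := Finset.single_le_sum
        (f := fun g : Fin n → ℝ => |g i| / (g ⬝ᵥ η))
        (fun g hg => div_nonneg (abs_nonneg _) (hg0 g hg)) hg
      rwa [div_le_iff₀ (hη g hg h0), mul_comm] at h1
  have hB0 : 0 ≤ B i := Finset.sum_nonneg fun g hg => div_nonneg (abs_nonneg _) (hg0 g hg)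
  have hsum : ∑ g ∈ s, c g * (g ⬝ᵥ η) ≤ L := by
    have h1 : (toReal a - γ) ⬝ᵥ η = ∑ g ∈ s, c g * (g ⬝ᵥ η) := by
      rw [hca, sum_dotProduct]
      simp only [smul_dotProduct, smul_eq_mul]
    rw [← h1, sub_dotProduct]
    exact sub_le_sub_right haM _
  have habs : |toReal a i - γ i| ≤ L * B i := by
    have h1 : toReal a i - γ i = ∑ g ∈ s, c g * g i := by
      have := congrFun hca i
      simpa [Finset.sum_apply] using this
    rw [h1]
    calc |∑ g ∈ s, c g * g i| ≤ ∑ g ∈ s, |c g * g i| := Finset.abs_sum_le_sum_abs _ _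
      _ ≤ ∑ g ∈ s, c g * (g ⬝ᵥ η) * B i := Finset.sum_le_sum fun g hg => by
          rw [abs_mul, abs_of_nonneg (hc g hg), mul_assoc]
          exact mul_le_mul_of_nonneg_left (hB g hg) (hc g hg)
      _ = (∑ g ∈ s, c g * (g ⬝ᵥ η)) * B i := by rw [Finset.sum_mul]
      _ ≤ L * B i := mul_le_mul_of_nonneg_right hsum hB0
  rw [abs_le] at habs
  simp only [toReal] at habs
  exact ⟨Int.ceil_le.2 (by linarith), Int.le_floor.2 (by linarith)⟩

/-- Perturb `ω` to a generic `x` such that `x - ω` is positive on the nonzero generators. Since `ω`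
exceeds `k` on the support, weight at most `M` for `x` means weight at most `M - k` for `x - ω`,
which leaves finitely many lattice points. -/
theorem tau_subset_closure_genericWeights [Zero K] {ξ : MvLaurentSeries n K} {γ : Fin n → ℝ}
    {s : Finset (Fin n → ℝ)} (hs : IsStronglyConvex (coneGeneratedBy s))
    (horth : orthant n ⊆ coneGeneratedBy s)
    (hξ : supp ξ ⊆ coneTranslate γ (coneGeneratedBy s)) :
    tau ξ ⊆ closure (genericWeights {a | ξ a ≠ 0}) := by
  intro ω hω
  obtain ⟨hω0, k, hk⟩ := mem_tau_iff.1 hω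
  rw [mem_closure_iff]
  intro O hO hωO
  obtain ⟨η, hη⟩ := positiveWeights_nonempty hs
  let O' : Set (Fin n → ℝ) := O ∩ {x | x - ω ∈ positiveWeights s}
  have hO' : IsOpen O' :=
    hO.inter ((isOpen_positiveWeights s).preimage (continuous_id.sub continuous_const))
  have hne : O'.Nonempty := by
    have h1 : Tendsto (fun r : ℝ => ω + r • η) (𝓝[>] 0) (𝓝 ω) := by
      have h2 : Continuous fun r : ℝ => ω + r • η := by fun_prop
      have h3 := h2.tendsto 0
      rw [zero_smul, add_zero] at h3
      exact h3.mono_left nhdsWithin_le_nhds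
    obtain ⟨r, hr, hr0⟩ := ((h1.eventually (hO.mem_nhds hωO)).and self_mem_nhdsWithin).exists
    refine ⟨ω + r • η, hr, ?_⟩
    rw [Set.mem_ofPred_eq, add_sub_cancel_left]
    exact smul_mem_positiveWeights hη hr0
  obtain ⟨x, hx, hinj⟩ := exists_injective_weight hO' hne
  have hxω : x - ω ∈ positiveWeights s := hx.2
  refine ⟨x, hx.1, fun i => ?_, hinj, fun M => ?_⟩
  · have h1 := pos_of_mem_positiveWeights horth hxω i
    have h2 := hω0 i
    rw [Pi.sub_apply] at h1
    linarith
  · refine ((finite_lattice_points hxω γ (M - k)).image toRat).subset ?_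
    rintro _ ⟨⟨a, ha, rfl⟩, haM⟩
    refine ⟨a, ⟨hξ ⟨a, ha, rfl⟩, ?_⟩, rfl⟩
    have h1 := hk a ha
    rw [weight_toRat] at haM
    rw [dotProduct_sub]
    linarith

/-- A single auxiliary weight suffices to pass to Hahn series: the resulting exchange property no
longer mentions it and serves for all ultrafilters. -/
theorem hasExchange_of_supp_subset [Field K] {ξ : MvLaurentSeries n K} {γ : Fin n → ℝ}
    {s : Finset (Fin n → ℝ)} (hs : IsStronglyConvex (coneGeneratedBy s))
    (horth : orthant n ⊆ coneGeneratedBy s)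
    (hξ : supp ξ ⊆ coneTranslate γ (coneGeneratedBy s)) (halg : IsAlgebraicOverPowerSeries ξ) :
    HasExchange {a | ξ a ≠ 0} := by
  obtain ⟨η, hη, hinj⟩ := exists_injective_weight (isOpen_positiveWeights s)
    (positiveWeights_nonempty hs)
  let w : (Fin n → ℤ) →+ ℝ :=
    { toFun := fun a => toReal a ⬝ᵥ η
      map_zero' := by simp [toReal, dotProduct]
      map_add' := fun a b => by rw [toReal_add, add_dotProduct] }
  have hw : Function.Injective w := fun a b h => by
    have h1 : weight η (toRat a) = weight η (toRat b) := by
      rw [weight_toRat, weight_toRat]; exact h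
    exact funext fun i => Int.cast_injective (congrFun (hinj h1) i)
  refine hasExchange_of_isAlgebraic hw (fun i => ?_) (fun M => ?_) halg
  · have h1 : toReal (Pi.single i 1 : Fin n → ℤ) = Pi.single i 1 := by
      ext j
      simp only [toReal, Pi.single_apply]
      split_ifs <;> simp
    have h2 : w (Pi.single i 1) = η i := by
      change toReal _ ⬝ᵥ η = _
      rw [h1, single_one_dotProduct]
    rw [h2]
    exact pos_of_mem_positiveWeights horth hη i
  · exact (finite_lattice_points hη γ M).subset fun a ha => ⟨hξ ⟨a, ha.1, rfl⟩, ha.2⟩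

end Tau

end LaurentCone

open LaurentCone in
theorem mainTheorem1 {n : ℕ} {K : Type*} [Field K] (ξ : MvLaurentSeries n K)
    (hsupp : ∃ (γ : Fin n → ℝ) (σ : Set (Fin n → ℝ)),
      IsPolyhedralCone σ ∧ IsStronglyConvex σ ∧ orthant n ⊆ σ ∧ supp ξ ⊆ coneTranslate γ σ)
    (halg : IsAlgebraicOverPowerSeries ξ) :
    IsRationalCone (tau ξ) ∧ IsStronglyConvex (tau ξ) := by
  classical
  refine ⟨?_, isStronglyConvex_tau ξ⟩
  obtain ⟨γ, σ, ⟨s, rfl⟩, hs, horth, hξ⟩ := hsupp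
  obtain ⟨𝒟, hfin, h𝒟, hcover⟩ :=
    exists_finite_cover (hasExchange_of_supp_subset hs horth hξ halg)
  have hclosed : IsClosed (⋃₀ 𝒟) := by
    rw [Set.sUnion_eq_biUnion]
    refine hfin.isClosed_biUnion fun C hC => ?_
    obtain ⟨ρ, -, -, rfl⟩ := h𝒟 C hC
    exact isClosed_dualInOrthant ρ
  have hgen : ∀ C ∈ 𝒟, ∃ G : Finset (Fin n → ℚ),
      (ratHull (G : Set (Fin n → ℚ)) : Set (Fin n → ℝ)) = C ∧ C ⊆ tau ξ := by
    intro C hC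
    obtain ⟨ρ, hfg, hwqo, rfl⟩ := h𝒟 C hC
    obtain ⟨G, hG⟩ := exists_ratHull_eq_dualInOrthant hfg
    exact ⟨G, hG, dualInOrthant_subset_tau hwqo⟩
  choose! G hG hGtau using hgen
  -- A convex cone that is a finite union of cones is generated by the union of their generators.
  let T : Finset (Fin n → ℚ) := hfin.toFinset.biUnion G
  have hT : tau ξ = ratHull (T : Set (Fin n → ℚ)) := by
    apply Set.Subset.antisymm
    · intro ω hω
      obtain ⟨C, hC, hωC⟩ := closure_minimal hcover hclosed
        (tau_subset_closure_genericWeights hs horth hξ hω)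
      rw [← hG C hC] at hωC
      exact ratHull_mono (Finset.coe_subset.2
        (Finset.subset_biUnion_of_mem G (hfin.mem_toFinset.2 hC))) hωC
    · have hle : ratHull (T : Set (Fin n → ℚ)) ≤ tauCone ξ := by
        refine ratHull_le_iff.2 fun q hq => ?_
        obtain ⟨C, hC, hqC⟩ := Finset.mem_biUnion.1 (Finset.mem_coe.1 hq)
        rw [hfin.mem_toFinset] at hC
        refine hGtau C hC ?_
        rw [← hG C hC]
        exact ratToReal_mem_ratHull hqC
      exact hle
  rw [hT]
  exact isRationalCone_ratHull T
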